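/- Let $n\ge 2$, let $S=\mathbb S^{n-1}\subset\mathbb R^n$ be the unit sphere with the round metric and Riemannian distance $d(x,y)=\arccos(x\cdot y)$, let $\exp_x$ be its exponential map, and let $D=\{(x,y)\in S\times S: y\ne -x\}$. Let $f:[0,\pi)\to\mathbb R$ be $C^\infty$ and strictly increasing with $f'(0)=0$, and put $f(\pi):=\lim_{t\uparrow\pi}f(t)\in\mathbb R\cup\{+\infty\}$ and $c(x,y)=f(d(x,y))$. Assume that $c$ satisfies on $D$: - (A0) $c\in C^4(D)$; - (A1) for every $x$ the map $y\mapsto-\nabla_xc(x,y)\in T_xS$ is injective on $D_x=\{y:y\neq -x\}$ (its inverse is denoted $\text{c-exp}_x$); - (A2) $\det D^2_{xy}c(x,y)\neq0$ for all $(x,y)\in D$; - (As) there is $C_0>0$ such that for all $(x_0,y_0)\in D$ and all $\xi,\nu\in T_{x_0}S$ with $\xi\perp\nu$, $$\frac{d^2}{dt^2}\Big|_{t=0}\frac{d^2}{ds^2}\Big|_{s=0}\Big[-c\big(\exp_{x_0}(s\xi),\ \text{c-exp}_{x_0}(-\nabla_xc(x_0,y_0)+t\nu)\big)\Big]\ \ge\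 C_0|\nu|^2|\xi|^2 .$$ For $\phi:S\to\mathbb R$ let $\phi^c(y)=\sup_{x\in S}\{-c(x,y)-\phi(x)\}$. Call $\phi:S\to\mathbb R$ c-convex if $\phi=\psi^c$ for some $\psi:S\to\mathbb R$, and let $G_\phi(x)=\{y\in S:\phi(x)+\phi^c(y)=-c(x,y)\}$. For $u:S\to[-\infty,+\infty]$ and a point $x$ at which $u(x)$ is finite, let $$\partial u(x)=\{p\in T_xS:\ u(\exp_x v)\ge u(x)+p\cdot v+o(|v|)\ \text{ as } v\to0 \text{ in } T_xS\},$$ let $\partial u(x)=\emptyset$ if $u(x)$ is infinite, and call $x$ a critical point of $u$ if $0\in\partial u(x)$. For $\phi$ c-convex let $\partial^c\phi(x)=\{-\nabla_xc(x,y): y\in G_\phi(x)\}$, where for $y=-x$ (where $c(\cdot,y)$ need not be differentiable at $x$) the symbol $-\nabla_xc(x,-x)$ stands for all elements of $\partial(-c(\cdot,-x))(x)$. Then: 1. For all $x,y_0,y_1\in S$ with $-x\notin\{y_0,y_1\}$, the c-segment with respect to $x$ $$[y_0,y_1]_x=\{y\in D_x:\ -\nabla_xc(x,y)\in[p_0,p_1]\},\qquad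 p_i=-\nabla_xc(x,y_i),$$ is well defined, i.e. $[p_0,p_1]\subset-\nabla_xc(x,D_x)$, and every $y\in[y_0,y_1]_x$ satisfies $y\ne-x$. 2. For every c-convex $\phi$ and every $y\in S$, the function $\phi+c(\cdot,y)$ attains its global maximum over $S$ at $-y$, and each of its critical points $x\neq -y$ is a global minimum point. 3. For every c-convex $\phi$ and every $x\in S$, $\partial\phi(x)=\partial^c\phi(x)$. -/

import Mathlib

open scoped Manifold ContDiff RealInnerProductSpace
open Filter Topology

noncomputable section

namespace SphereCost

/-- The ambient Euclidean space `ℝ^(m+1)`. -/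
abbrev Amb (m : ℕ) : Type := EuclideanSpace ℝ (Fin (m + 1))

/-- The unit sphere `S^m` of `ℝ^(m+1)`. -/
abbrev Sph (m : ℕ) : Type := Metric.sphere (0 : Amb m) 1

/-- The tangent space of the sphere at `x`, i.e. the hyperplane orthogonal to `x`, with the inner
product induced from the ambient space (the round metric). -/
abbrev Tan {m : ℕ} (x : Sph m) : Submodule ℝ (Amb m) := (ℝ ∙ (x : Amb m))ᗮ

/-- The Riemannian distance of the round sphere: the angle `arccos ⟪x, y⟫`, with values in
`[0, π]`. -/
def sphDist {m : ℕ} (x y : Sph m) : ℝ := Real.arccos ⟪(x : Amb m), (y : Amb m)⟫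

/-- The point `cos |v| x + (sin |v| / |v|) v` of the ambient space. -/
def expVec {m : ℕ} (x : Sph m) (v : Tan x) : Amb m :=
  Real.cos ‖v‖ • (x : Amb m) + Real.sinc ‖v‖ • (v : Amb m)

theorem expVec_mem {m : ℕ} (x : Sph m) (v : Tan x) :
    expVec x v ∈ Metric.sphere (0 : Amb m) 1 := by
  have hx : ‖(x : Amb m)‖ = 1 := norm_eq_of_mem_sphere x
  have hxv : ⟪(x : Amb m), (v : Amb m)⟫ = 0 :=
    Submodule.mem_orthogonal_singleton_iff_inner_right.mp v.2
  have hs : Real.sinc ‖v‖ * ‖v‖ = Real.sin ‖v‖ := by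
    by_cases h : ‖v‖ = 0
    · simp [h]
    · rw [Real.sinc_of_ne_zero h]; field_simp
  have h0 : ⟪Real.cos ‖v‖ • (x : Amb m), Real.sinc ‖v‖ • (v : Amb m)⟫ = 0 := by
    rw [real_inner_smul_left, real_inner_smul_right, hxv]; simp
  have h := norm_add_sq_eq_norm_sq_add_norm_sq_of_inner_eq_zero _ _ h0
  have h1 : ‖expVec x v‖ * ‖expVec x v‖ = 1 := by
    have e1 : ‖Real.cos ‖v‖ • (x : Amb m)‖ * ‖Real.cos ‖v‖ • (x : Amb m)‖
        = Real.cos ‖v‖ ^ 2 := by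
      rw [norm_smul, hx, mul_one, Real.norm_eq_abs, abs_mul_abs_self, sq]
    have e2 : ‖Real.sinc ‖v‖ • (v : Amb m)‖ * ‖Real.sinc ‖v‖ • (v : Amb m)‖
        = Real.sin ‖v‖ ^ 2 := by
      rw [norm_smul, Real.norm_eq_abs, ← hs]
      have : ‖(v : Amb m)‖ = ‖v‖ := rfl
      rw [this, mul_mul_mul_comm, abs_mul_abs_self]; ring
    unfold expVec
    rw [h, e1, e2, Real.cos_sq_add_sin_sq]
  rw [mem_sphere_zero_iff_norm]
  nlinarith [norm_nonneg (expVec x v)]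

/-- The Riemannian exponential map of the round sphere at `x`. -/
def sphExp {m : ℕ} (x : Sph m) (v : Tan x) : Sph m := ⟨expVec x v, expVec_mem x v⟩

/-- The complement of the antidiagonal in `S^m × S^m`. -/
def offAnti (m : ℕ) : Set (Sph m × Sph m) := {z | z.2 ≠ -z.1}

/-- The extension of `f : [0, π) → ℝ` to `[0, π]` by its supremum at `π`; for increasing `f`
this is the limit of `f` at `π`, which may be `+∞`. -/
def extendPi (f : ℝ → ℝ) (t : ℝ) : EReal :=
  if t < Real.pi then (f t : EReal) else ⨆ s ∈ Set.Ico 0 Real.pi, (f s : EReal)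

/-- The cost `c(x,y) = f(d(x,y))`, with values in `ℝ ∪ {+∞}`. -/
def radialCost {m : ℕ} (f : ℝ → ℝ) (x y : Sph m) : EReal := extendPi f (sphDist x y)

section GeneralCost

variable {m : ℕ} (c : Sph m → Sph m → EReal)

/-- The Riemannian gradient `∇ₓ c(x,y) ∈ T_x` of `c(·,y)` at `x`, computed in normal coordinates
at `x`; it is used where `c(·,y)` is finite and differentiable. -/
def gradX (x y : Sph m) : Tan x := gradient (fun v : Tan x => (c (sphExp x v) y).toReal) 0

/-- The mixed second derivative `D²_{xy} c(x,y)`, as the derivative at `y` of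
`y' ↦ ∇ₓ c(x,y')`, a linear map from `T_y` to `T_x`. -/
def mixedHess (x y : Sph m) : Tan y →L[ℝ] Tan x :=
  fderiv ℝ (fun w : Tan y => gradX c x (sphExp y w)) 0

/-- A0: the cost is of class `C⁴` off the antidiagonal. -/
def CondA0 : Prop :=
  ContMDiffOn ((𝓡 m).prod (𝓡 m)) 𝓘(ℝ, ℝ) 4
    (fun z : Sph m × Sph m => (c z.1 z.2).toReal) (offAnti m)

/-- A1: for every `x`, the map `y ↦ -∇ₓ c(x,y)` is injective off `-x`. -/
def CondA1 : Prop :=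
  ∀ x : Sph m, Set.InjOn (fun y : Sph m => -gradX c x y) {y | (x, y) ∈ offAnti m}

/-- A2: `det D²_{xy} c(x,y) ≠ 0` off the antidiagonal, the determinant being that of the matrix in
orthonormal bases of the two tangent spaces. -/
def CondA2 : Prop :=
  ∀ x y : Sph m, (x, y) ∈ offAnti m →
    ∀ (b : OrthonormalBasis (Fin m) ℝ (Tan x)) (b' : OrthonormalBasis (Fin m) ℝ (Tan y)),
      (LinearMap.toMatrix b'.toBasis b.toBasis
        (mixedHess c x y : Tan y →ₗ[ℝ] Tan x)).det ≠ 0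

/-- The c-exponential map at `x`, the inverse of `y ↦ -∇ₓ c(x,y)` on `{y | y ≠ -x}`
(an arbitrary value is taken outside the image). -/
def cExp (x : Sph m) (p : Tan x) : Sph m :=
  haveI : Nonempty (Sph m) := ⟨x⟩
  Function.invFunOn (fun y : Sph m => -gradX c x y) {y | (x, y) ∈ offAnti m} p

/-- The cost-sectional curvature
`D⁴_{p_ν p_ν x_ξ x_ξ} [(x,p) ↦ -c(x, c-exp_{x₀}(p))]` at `(x₀, p₀)`, `p₀ = -∇ₓ c(x₀,y₀)`,
computed in normal coordinates at `x₀`. -/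
def costCurv (x₀ y₀ : Sph m) (ξ ν : Tan x₀) : ℝ :=
  iteratedDeriv 2 (fun t : ℝ =>
    iteratedDeriv 2 (fun s : ℝ =>
      -(c (sphExp x₀ (s • ξ)) (cExp c x₀ (-gradX c x₀ y₀ + t • ν))).toReal) 0) 0

/-- As: the cost-sectional curvature is uniformly positive off the antidiagonal. -/
def CondAs : Prop :=
  ∃ C₀ : ℝ, 0 < C₀ ∧ ∀ x₀ y₀ : Sph m, (x₀, y₀) ∈ offAnti m →
    ∀ ξ ν : Tan x₀, ⟪ξ, ν⟫ = 0 → C₀ * ‖ν‖ ^ 2 * ‖ξ‖ ^ 2 ≤ costCurv c x₀ y₀ ξ ν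

/-- The c-segment `[y₀, y₁]_x`. -/
def cSegment (x y₀ y₁ : Sph m) : Set (Sph m) :=
  {y | (x, y) ∈ offAnti m ∧ -gradX c x y ∈ segment ℝ (-gradX c x y₀) (-gradX c x y₁)}

/-- The condition under which the c-segment `[y₀, y₁]_x` is well defined: the segment between
`-∇ₓ c(x,y₀)` and `-∇ₓ c(x,y₁)` is contained in the image of `{y | y ≠ -x}` under
`y ↦ -∇ₓ c(x,y)`. -/
def CSegmentWellDefined (x y₀ y₁ : Sph m) : Prop :=
  segment ℝ (-gradX c x y₀) (-gradX c x y₁) ⊆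
    (fun y : Sph m => -gradX c x y) '' {y | (x, y) ∈ offAnti m}

/-- The c-transform `φᶜ(x) = sup_y {-c(x,y) - φ(y)}` (the costs considered are symmetric). -/
def cTransform (φ : Sph m → ℝ) (x : Sph m) : EReal := ⨆ y : Sph m, (-(c x y) - (φ y : EReal))

/-- A real-valued function is c-convex if it is the c-transform of some real-valued function. -/
def IsCConvex (φ : Sph m → ℝ) : Prop :=
  ∃ ψ : Sph m → ℝ, ∀ x, (φ x : EReal) = cTransform c ψ x

/-- The contact set `G_φ(x) = {y | φ(x) + φᶜ(y) = -c(x,y)}`. -/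
def contactSet (φ : Sph m → ℝ) (x : Sph m) : Set (Sph m) :=
  {y | (φ x : EReal) + cTransform c φ y = -(c x y)}

/-- The subdifferential `∂u(x)`: all `p ∈ T_x` with
`u(x') ≥ u(x) + ⟪p, exp_x⁻¹(x')⟫ + o(d(x,x'))`, where `x' = exp_x(v)`. It is empty if `u(x)` is
infinite. -/
def subdiff (u : Sph m → EReal) (x : Sph m) : Set (Tan x) :=
  {p | ∃ a : ℝ, u x = (a : EReal) ∧ ∀ ε : ℝ, 0 < ε → ∀ᶠ v in 𝓝 (0 : Tan x),
    ((a + ⟪p, v⟫ - ε * ‖v‖ : ℝ) : EReal) ≤ u (sphExp x v)}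

/-- `x` is a critical point of `u` if `0 ∈ ∂u(x)`. -/
def IsCritical (u : Sph m → EReal) (x : Sph m) : Prop := (0 : Tan x) ∈ subdiff u x

/-- The c-subdifferential `∂ᶜφ(x) = {-∇ₓ c(x,y) | y ∈ G_φ(x)}`. For `y = -x`, where `c(·,y)` need
not be differentiable at `x`, the gradient is multivalued: `-∇ₓ c(x,-x)` stands for all elements
of the subdifferential of `-c(·,-x)` at `x`. -/
def cSubdiff (φ : Sph m → ℝ) (x : Sph m) : Set (Tan x) :=
  {p | (∃ y ∈ contactSet c φ x, y ≠ -x ∧ p = -gradX c x y) ∨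
    (-x ∈ contactSet c φ x ∧ p ∈ subdiff (fun x' => -(c x' (-x))) x)}

end GeneralCost

end SphereCost

end

/-!
The cost is a function of `u = ⟪x,y⟫` alone, `c(x,y) = F(u)` (`cosProfile`), and its momentum
`-∇ₓ c(x,y) = M(u) (y - u x)`, with `M = -F'`, points from `x` towards `y` and has norm `f'(d(x,y))`.
Hence A1 makes `f'` strictly increasing and A2 makes `f''` positive on `(0, π)`
(`IsProfile.isConvexProfile`). The momenta at `x` therefore fill a ball around the origin, which is
convex, and this is the first item.

That `φ + c(·,y)` is largest at `-y` follows from the convexity of `f` and the triangle inequality,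
which give `c(x,y) + c(-y,z) ≤ c(-y,y) + c(x,z)` (`radialCost_add_le`).

Condition As enters through the Hessian of `-c(·,y)` at `x` in a direction `ξ`: written as a function
of the momentum, it is strictly convex on segments orthogonal to `ξ` (`strictConvexOn_hessForm`).
Suppose that `c(x₀,·) - c(x₁,·)` has a local maximum at a point `y` of a c-segment with respect to
`x₀`. By symmetry of the cost, its gradient at `y` is the difference of the momenta at `y` of `x₁` and
`x₀`, and this difference is orthogonal to the velocity `ξ` of the c-segment. The acceleration of the
c-segment, paired with this difference, turns out to be minus the derivative of the Hessian form at
the momentum of `x₀` (`inner_acceleration`, `hasDerivAt_hessForm_line`), so that the second-order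
condition says that the Hessian form at the momentum of `x₁` does not exceed its tangent at that of
`x₀`, against strict convexity (`not_localMax_along_segment`). Together with compactness, and the
minimality of the difference at the antipode of `x₁`, where it need not be smooth, this gives Loeper's
maximum principle (`cost_sub_le_max`): on a c-segment with respect to `x₀`, the difference is bounded by its values at
the ends.

Consequently the momenta of the contact points of a c-convex `φ` at `x` form a convex set
(`convex_momentum_image`), unless `-x` is a contact point. It is compact, and every subgradient of
`φ` is dominated in every direction by one of its elements (`exists_contact_inner_le`), so it contains
all subgradients by the Hahn-Banach theorem. If `-x` is a contact point, then `φ + c(·,-x)` is both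
largest and smallest at `x`, so it is constant and the subdifferentials agree trivially. Finally,
a critical point of `φ + c(·,y)` off the antipode of `y` gives the subgradient `-∇ₓ c(x,y)` of `φ`,
hence a contact point.
-/

noncomputable section

namespace SphereCost

/-! ### The profile of the cost -/

/-- The derivative `f'` of the profile on `[0, π)`, one-sided at `0`. -/
def profDeriv (f : ℝ → ℝ) : ℝ → ℝ := derivWithin f (Set.Ico 0 Real.pi)

/-- The second derivative `f''` of the profile on `[0, π)`, one-sided at `0`. -/
def profDeriv2 (f : ℝ → ℝ) : ℝ → ℝ := derivWithin (profDeriv f) (Set.Ico 0 Real.pi)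

/-- The factor `M(u) = f'(r) / sin r`, `u = cos r`, for which `-∇ₓ c(x,y) = M(⟪x,y⟫) (y - ⟪x,y⟫ x)`.
From `u = 1` on it is constant, equal to its limit `f''(0)` at `1`. -/
def radialFactor (f : ℝ → ℝ) (u : ℝ) : ℝ :=
  if u < 1 then profDeriv f (Real.arccos u) / √(1 - u ^ 2) else profDeriv2 f 0

/-- The cost as a function of `u = ⟪x,y⟫`. It is continued beyond `u = 1` by its tangent line, so
that it becomes a `C¹` function on a neighbourhood of `(-1, 1]`. -/
def cosProfile (f : ℝ → ℝ) (u : ℝ) : ℝ :=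
  if u < 1 then f (Real.arccos u) else f 0 - profDeriv2 f 0 * (u - 1)

/-- The hypotheses on the profile `f` alone. -/
structure IsProfile (f : ℝ → ℝ) : Prop where
  smooth : ContDiffOn ℝ ∞ f (Set.Ico 0 Real.pi)
  mono : StrictMonoOn f (Set.Ico 0 Real.pi)
  zero : profDeriv f 0 = 0

theorem Ico_pi_mem_nhds {r : ℝ} (hr : r ∈ Set.Ioo 0 Real.pi) : Set.Ico 0 Real.pi ∈ 𝓝 r :=
  Ico_mem_nhds hr.1 hr.2

theorem zero_mem_Ico_pi : (0 : ℝ) ∈ Set.Ico 0 Real.pi := ⟨le_rfl, Real.pi_pos⟩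

theorem Ioo_pi_sub_Ico {r : ℝ} (hr : r ∈ Set.Ioo 0 Real.pi) : r ∈ Set.Ico 0 Real.pi :=
  ⟨hr.1.le, hr.2⟩

theorem arccos_mem_Ioo {u : ℝ} (h : -1 < u) (h' : u < 1) : Real.arccos u ∈ Set.Ioo 0 Real.pi :=
  ⟨Real.arccos_pos.2 h', by
    rw [← Real.arccos_neg_one]
    exact Real.strictAntiOn_arccos ⟨le_rfl, by norm_num⟩ ⟨h.le, h'.le⟩ h⟩

theorem one_sub_sq_pos {u : ℝ} (h : -1 < u) (h' : u < 1) : 0 < 1 - u ^ 2 := by nlinarith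

namespace IsProfile

variable {f : ℝ → ℝ} (hf : IsProfile f)

include hf

theorem contDiffOn_profDeriv : ContDiffOn ℝ ∞ (profDeriv f) (Set.Ico 0 Real.pi) :=
  hf.smooth.derivWithin (uniqueDiffOn_Ico _ _) (by simp)

theorem contDiffAt_profDeriv {r : ℝ} (hr : r ∈ Set.Ioo 0 Real.pi) :
    ContDiffAt ℝ ∞ (profDeriv f) r :=
  hf.contDiffOn_profDeriv.contDiffAt (Ico_pi_mem_nhds hr)

theorem hasDerivWithinAt {r : ℝ} (hr : r ∈ Set.Ico 0 Real.pi) :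
    HasDerivWithinAt f (profDeriv f r) (Set.Ico 0 Real.pi) r :=
  ((hf.smooth.differentiableOn (by simp)) r hr).hasDerivWithinAt

theorem hasDerivAt {r : ℝ} (hr : r ∈ Set.Ioo 0 Real.pi) : HasDerivAt f (profDeriv f r) r :=
  (hf.hasDerivWithinAt (Ioo_pi_sub_Ico hr)).hasDerivAt (Ico_pi_mem_nhds hr)

theorem hasDerivWithinAt_profDeriv {r : ℝ} (hr : r ∈ Set.Ico 0 Real.pi) :
    HasDerivWithinAt (profDeriv f) (profDeriv2 f r) (Set.Ico 0 Real.pi) r :=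
  ((hf.contDiffOn_profDeriv.differentiableOn (by simp)) r hr).hasDerivWithinAt

theorem hasDerivAt_profDeriv {r : ℝ} (hr : r ∈ Set.Ioo 0 Real.pi) :
    HasDerivAt (profDeriv f) (profDeriv2 f r) r :=
  (hf.hasDerivWithinAt_profDeriv (Ioo_pi_sub_Ico hr)).hasDerivAt (Ico_pi_mem_nhds hr)

theorem profDeriv_nonneg (r : ℝ) : 0 ≤ profDeriv f r :=
  hf.mono.monotoneOn.derivWithin_nonneg

/-- `f'(r) / sin r → f''(0)` as `r ↓ 0`. -/
theorem tendsto_profDeriv_div_sin :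
    Tendsto (fun r => profDeriv f r / Real.sin r) (𝓝[>] 0) (𝓝 (profDeriv2 f 0)) := by
  have h1 := hf.hasDerivWithinAt_profDeriv zero_mem_Ico_pi
  have h2 : HasDerivWithinAt (profDeriv f) (profDeriv2 f 0) (Set.Ioi 0) 0 :=
    (h1.mono_of_mem_nhdsWithin (t := Set.Ico 0 Real.pi)
      self_mem_nhdsWithin).mono_of_mem_nhdsWithin
        (mem_of_superset (Ioo_mem_nhdsGT Real.pi_pos) Set.Ioo_subset_Ico_self)
  have h3 := (hasDerivWithinAt_iff_tendsto_slope' (by simp)).1 h2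
  have h4 : Tendsto Real.sinc (𝓝[>] 0) (𝓝 1) := by
    have := Real.continuous_sinc.tendsto 0
    rw [Real.sinc_zero] at this
    exact this.mono_left nhdsWithin_le_nhds
  have h5 := h3.div h4 one_ne_zero
  rw [div_one] at h5
  refine h5.congr' ?_
  filter_upwards [Ioo_mem_nhdsGT Real.pi_pos] with r hr
  have hs := Real.sin_pos_of_pos_of_lt_pi hr.1 hr.2
  have hr0 := hr.1.ne'
  simp only [Pi.div_apply, slope_def_field, hf.zero, sub_zero, Real.sinc_of_ne_zero hr0]
  field_simp

theorem continuousAt_radialFactor_one : ContinuousAt (radialFactor f) 1 := by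
  rw [continuousAt_iff_continuous_left'_right']
  constructor
  · have h1 : Tendsto Real.arccos (𝓝[<] 1) (𝓝[>] 0) := by
      refine tendsto_nhdsWithin_iff.2 ⟨?_, ?_⟩
      · have := (Real.continuous_arccos.tendsto 1).mono_left
          (nhdsWithin_le_nhds (s := Set.Iio (1 : ℝ)))
        rwa [Real.arccos_one] at this
      · filter_upwards [self_mem_nhdsWithin] with u hu
        exact Real.arccos_pos.2 hu
    have h2 := hf.tendsto_profDeriv_div_sin.comp h1
    have h3 : radialFactor f 1 = profDeriv2 f 0 := by simp [radialFactor]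
    unfold ContinuousWithinAt
    rw [h3]
    refine h2.congr' ?_
    filter_upwards [self_mem_nhdsWithin] with u hu
    simp only [Function.comp, Real.sin_arccos, radialFactor, if_pos (show u < 1 from hu)]
  · refine (continuousWithinAt_const (b := profDeriv2 f 0)).congr (fun u hu => ?_) ?_
    · simp [radialFactor, not_lt.2 (le_of_lt (show (1 : ℝ) < u from hu))]
    · simp [radialFactor]

theorem contDiffAt_radialFactor {u : ℝ} (h : -1 < u) (h' : u < 1) :
    ContDiffAt ℝ ∞ (radialFactor f) u := by
  have h1 : ContDiffAt ℝ ∞ (fun u => profDeriv f (Real.arccos u) / √(1 - u ^ 2)) u := by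
    refine ContDiffAt.div ?_ ?_ (Real.sqrt_pos.2 (one_sub_sq_pos h h')).ne'
    · exact (hf.contDiffAt_profDeriv (arccos_mem_Ioo h h')).comp u
        (Real.contDiffAt_arccos h.ne' h'.ne)
    · exact ContDiffAt.sqrt (by fun_prop) (one_sub_sq_pos h h').ne'
  refine h1.congr_of_eventuallyEq ?_
  filter_upwards [Iio_mem_nhds h'] with v hv
  simp [radialFactor, if_pos (show v < 1 from hv)]

theorem continuousAt_radialFactor {u : ℝ} (h : -1 < u) : ContinuousAt (radialFactor f) u := by
  rcases lt_trichotomy u 1 with h' | rfl | h'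
  · exact (hf.contDiffAt_radialFactor h h').continuousAt
  · exact hf.continuousAt_radialFactor_one
  · refine (continuousAt_const (y := profDeriv2 f 0)).congr ?_
    filter_upwards [Ioi_mem_nhds h'] with v hv
    simp [radialFactor, not_lt.2 (le_of_lt (show (1 : ℝ) < v from hv))]

theorem radialFactor_mul_sqrt {u : ℝ} (h : -1 < u) (h' : u ≤ 1) :
    radialFactor f u * √(1 - u ^ 2) = profDeriv f (Real.arccos u) := by
  rcases h'.lt_or_eq with h' | rfl
  · have := (Real.sqrt_pos.2 (one_sub_sq_pos h h')).ne'
    simp only [radialFactor, if_pos h']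
    field_simp
  · simp [hf.zero]

/-- The derivative of `M`, in the form `(1 - u²) M'(u) = u M(u) - f''(arccos u)`. -/
theorem one_sub_sq_mul_deriv_radialFactor {u : ℝ} (h : -1 < u) (h' : u < 1) :
    (1 - u ^ 2) * deriv (radialFactor f) u
      = u * radialFactor f u - profDeriv2 f (Real.arccos u) := by
  have hM : HasDerivAt (radialFactor f) (deriv (radialFactor f) u) u :=
    ((hf.contDiffAt_radialFactor h h').differentiableAt (by simp)).hasDerivAt
  have hp := one_sub_sq_pos h h'
  have hsp := Real.sqrt_pos.2 hp
  have hs : HasDerivAt (fun v : ℝ => √(1 - v ^ 2)) (-(2 * u) / (2 * √(1 - u ^ 2))) u := by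
    have h1 : HasDerivAt (fun v : ℝ => 1 - v ^ 2) (-(2 * u)) u := by
      simpa using ((hasDerivAt_pow 2 u).const_sub 1)
    exact h1.sqrt hp.ne'
  have h1 := hM.mul hs
  have h2 := (hf.hasDerivAt_profDeriv (arccos_mem_Ioo h h')).comp u
    (Real.hasDerivAt_arccos h.ne' h'.ne)
  have h3 : (fun v => radialFactor f v * √(1 - v ^ 2)) =ᶠ[𝓝 u] profDeriv f ∘ Real.arccos := by
    filter_upwards [Ioo_mem_nhds h h'] with v hv
    exact hf.radialFactor_mul_sqrt hv.1 hv.2.le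
  have h4 := h1.unique (h2.congr_of_eventuallyEq h3)
  have hsq : √(1 - u ^ 2) ^ 2 = 1 - u ^ 2 := Real.sq_sqrt hp.le
  field_simp at h4
  rw [hsq] at h4
  linarith

theorem continuousAt_cosProfile_one : ContinuousAt (cosProfile f) 1 := by
  have h0 : cosProfile f 1 = f 0 := by simp [cosProfile]
  rw [continuousAt_iff_continuous_left'_right']
  constructor
  · have h1 : Tendsto Real.arccos (𝓝[<] 1) (𝓝[Set.Ico 0 Real.pi] 0) := by
      refine tendsto_nhdsWithin_iff.2 ⟨?_, ?_⟩
      · have := (Real.continuous_arccos.tendsto 1).mono_left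
          (nhdsWithin_le_nhds (s := Set.Iio (1 : ℝ)))
        rwa [Real.arccos_one] at this
      · filter_upwards [Ioo_mem_nhdsLT (show (-1 : ℝ) < 1 by norm_num)] with u hu
        exact Ioo_pi_sub_Ico (arccos_mem_Ioo hu.1 hu.2)
    have h2 : Tendsto f (𝓝[Set.Ico 0 Real.pi] 0) (𝓝 (f 0)) :=
      hf.smooth.continuousOn 0 zero_mem_Ico_pi
    unfold ContinuousWithinAt
    rw [h0]
    refine (h2.comp h1).congr' ?_
    filter_upwards [self_mem_nhdsWithin] with u hu
    simp only [Function.comp, cosProfile, if_pos (show u < 1 from hu)]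
  · refine (Continuous.continuousWithinAt (f := fun u => f 0 - profDeriv2 f 0 * (u - 1))
      (by fun_prop)).congr (fun u hu => ?_) ?_
    · simp [cosProfile, not_lt.2 (le_of_lt (show (1 : ℝ) < u from hu))]
    · simp [cosProfile]

theorem hasDerivAt_cosProfile {u : ℝ} (h : -1 < u) :
    HasDerivAt (cosProfile f) (-radialFactor f u) u := by
  have key : ∀ v, -1 < v → v ≠ 1 → HasDerivAt (cosProfile f) (-radialFactor f v) v := by
    intro v hv hv1
    rcases lt_or_gt_of_ne hv1 with h' | h'
    · have h2 := (hf.hasDerivAt (arccos_mem_Ioo hv h')).comp v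
        (Real.hasDerivAt_arccos hv.ne' h'.ne)
      refine (h2.congr_of_eventuallyEq ?_).congr_deriv ?_
      · filter_upwards [Iio_mem_nhds h'] with w hw
        simp [cosProfile, if_pos (show w < 1 from hw)]
      · simp only [radialFactor, if_pos h']
        ring
    · have h2 : HasDerivAt (fun u => f 0 - profDeriv2 f 0 * (u - 1)) (-profDeriv2 f 0) v := by
        simpa using (((hasDerivAt_id v).sub_const 1).const_mul (profDeriv2 f 0)).const_sub (f 0)
      refine (h2.congr_of_eventuallyEq ?_).congr_deriv ?_
      · filter_upwards [Ioi_mem_nhds h'] with w hw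
        simp [cosProfile, not_lt.2 (le_of_lt (show (1 : ℝ) < w from hw))]
      · simp [radialFactor, not_lt.2 h'.le]
  by_cases h1 : u = 1
  · subst h1
    -- the two halves are glued by the continuity of the derivative at `1`
    have hloc : ∀ v ∈ Set.Ioo (0 : ℝ) 2, v ≠ 1 →
        HasDerivAt (cosProfile f) (-radialFactor f v) v :=
      fun v hv => key v (by linarith [hv.1])
    have hd : ∀ v ∈ Set.Ioo (0 : ℝ) 2, v ≠ 1 → deriv (cosProfile f) v = -radialFactor f v :=
      fun v hv hv1 => (hloc v hv hv1).deriv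
    have hL : HasDerivWithinAt (cosProfile f) (-radialFactor f 1) (Set.Iic 1) 1 := by
      refine hasDerivWithinAt_Iic_of_tendsto_deriv (s := Set.Ioo 0 1)
        (fun v hv => (hloc v ⟨hv.1, by linarith [hv.2]⟩ hv.2.ne).differentiableAt
          |>.differentiableWithinAt) hf.continuousAt_cosProfile_one.continuousWithinAt
        (Ioo_mem_nhdsLT one_pos) ?_
      refine ((hf.continuousAt_radialFactor_one.neg.tendsto).mono_left
        nhdsWithin_le_nhds).congr' ?_
      filter_upwards [Ioo_mem_nhdsLT one_pos] with v hv
      exact (hd v ⟨hv.1, by linarith [hv.2]⟩ hv.2.ne).symm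
    have hR : HasDerivWithinAt (cosProfile f) (-radialFactor f 1) (Set.Ici 1) 1 := by
      refine hasDerivWithinAt_Ici_of_tendsto_deriv (s := Set.Ioo 1 2)
        (fun v hv => (hloc v ⟨by linarith [hv.1], hv.2⟩ hv.1.ne').differentiableAt
          |>.differentiableWithinAt) hf.continuousAt_cosProfile_one.continuousWithinAt
        (Ioo_mem_nhdsGT one_lt_two) ?_
      refine ((hf.continuousAt_radialFactor_one.neg.tendsto).mono_left
        nhdsWithin_le_nhds).congr' ?_
      filter_upwards [Ioo_mem_nhdsGT one_lt_two] with v hv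
      exact (hd v ⟨by linarith [hv.1], hv.2⟩ hv.1.ne').symm
    simpa using hL.union hR
  · exact key u h h1

theorem hasStrictDerivAt_cosProfile {u : ℝ} (h : -1 < u) :
    HasStrictDerivAt (cosProfile f) (-radialFactor f u) u :=
  hasStrictDerivAt_of_hasDerivAt_of_continuousAt
    (mem_of_superset (Ioi_mem_nhds h) fun _ hv => hf.hasDerivAt_cosProfile hv)
    (hf.continuousAt_radialFactor h).neg

end IsProfile

/-! ### Geometry of the sphere -/

section Sphere

variable {m : ℕ}

theorem norm_coe_sph (x : Sph m) : ‖(x : Amb m)‖ = 1 := norm_eq_of_mem_sphere x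

theorem inner_self_sph (x : Sph m) : ⟪(x : Amb m), (x : Amb m)⟫ = 1 := by
  rw [real_inner_self_eq_norm_sq, norm_coe_sph]; norm_num

theorem inner_sph_le_one (x y : Sph m) : ⟪(x : Amb m), (y : Amb m)⟫ ≤ 1 := by
  simpa [norm_coe_sph] using real_inner_le_norm (x : Amb m) (y : Amb m)

theorem neg_one_le_inner_sph (x y : Sph m) : -1 ≤ ⟪(x : Amb m), (y : Amb m)⟫ := by
  simpa [norm_coe_sph] using neg_le_of_abs_le (abs_real_inner_le_norm (x : Amb m) (y : Amb m))

theorem inner_sph_eq_one_iff {x y : Sph m} : ⟪(x : Amb m), (y : Amb m)⟫ = 1 ↔ x = y := by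
  rw [inner_eq_one_iff_of_norm_eq_one (norm_coe_sph x) (norm_coe_sph y), Subtype.coe_inj]

theorem inner_sph_eq_neg_one_iff {x y : Sph m} : ⟪(x : Amb m), (y : Amb m)⟫ = -1 ↔ y = -x := by
  have h : ⟪((-x : Sph m) : Amb m), (y : Amb m)⟫ = -⟪(x : Amb m), (y : Amb m)⟫ := by simp
  rw [eq_comm (a := y), ← inner_sph_eq_one_iff, h]
  constructor <;> intro h <;> linarith

theorem neg_one_lt_inner_iff {x y : Sph m} : -1 < ⟪(x : Amb m), (y : Amb m)⟫ ↔ y ≠ -x := by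
  rw [(neg_one_le_inner_sph x y).lt_iff_ne, ne_comm, Ne, inner_sph_eq_neg_one_iff]

theorem ne_neg_comm {x y : Sph m} : y ≠ -x ↔ x ≠ -y := by
  rw [← neg_one_lt_inner_iff, ← neg_one_lt_inner_iff, real_inner_comm]

theorem inner_sph_lt_one_iff {x y : Sph m} : ⟪(x : Amb m), (y : Amb m)⟫ < 1 ↔ x ≠ y := by
  rw [(inner_sph_le_one x y).lt_iff_ne, Ne, inner_sph_eq_one_iff]

theorem sphDist_mem_Ico {x y : Sph m} (h : y ≠ -x) : sphDist x y ∈ Set.Ico 0 Real.pi := by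
  refine ⟨Real.arccos_nonneg _, ?_⟩
  have h := neg_one_lt_inner_iff.2 h
  rcases (inner_sph_le_one x y).lt_or_eq with h1 | h1
  · exact (arccos_mem_Ioo h h1).2
  · simp [sphDist, h1, Real.pi_pos]

theorem sphDist_self (x : Sph m) : sphDist x x = 0 := by simp [sphDist]

theorem sphDist_comm (x y : Sph m) : sphDist x y = sphDist y x := by
  simp [sphDist, real_inner_comm]

theorem sphDist_neg (x : Sph m) : sphDist x (-x) = Real.pi := by
  simp [sphDist]

theorem self_ne_neg (x : Sph m) : x ≠ -x := fun h => by
  have := sphDist_neg x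
  rw [← h, sphDist_self] at this
  exact Real.pi_pos.ne this

theorem sphDist_neg_left (x y : Sph m) : sphDist (-x) y = Real.pi - sphDist x y := by
  simp [sphDist, Real.arccos_neg]

theorem sphDist_triangle (x y z : Sph m) : sphDist x z ≤ sphDist x y + sphDist y z := by
  have h : ∀ a b : Sph m, sphDist a b = InnerProductGeometry.angle (a : Amb m) (b : Amb m) := by
    intro a b; simp [sphDist, InnerProductGeometry.angle]
  rw [h, h, h]
  exact InnerProductGeometry.angle_le_angle_add_angle _ _ _

theorem cos_sphDist (x y : Sph m) : Real.cos (sphDist x y) = ⟪(x : Amb m), (y : Amb m)⟫ :=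
  Real.cos_arccos (neg_one_le_inner_sph x y) (inner_sph_le_one x y)

instance finrank_amb_fact : Fact (Module.finrank ℝ (Amb m) = m + 1) := ⟨by simp⟩

theorem sph_ne_zero (x : Sph m) : (x : Amb m) ≠ 0 := by
  intro h; simpa [h] using norm_coe_sph x

theorem exists_unit_tangent (hm : 1 ≤ m) (x : Sph m) : ∃ e : Tan x, ‖e‖ = 1 :=
  ⟨OrthonormalBasis.fromOrthogonalSpanSingleton m (sph_ne_zero x) ⟨0, hm⟩, by simp⟩

theorem inner_tan (x : Sph m) (v : Tan x) : ⟪(x : Amb m), (v : Amb m)⟫ = 0 :=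
  Submodule.mem_orthogonal_singleton_iff_inner_right.mp v.2

/-- The orthogonal projection of a vector to the tangent space at `x`. -/
def tanProj (x : Sph m) (z : Amb m) : Tan x :=
  ⟨z - ⟪(x : Amb m), z⟫ • (x : Amb m), by
    rw [Submodule.mem_orthogonal_singleton_iff_inner_right, inner_sub_right,
      real_inner_smul_right, inner_self_sph]; ring⟩

theorem coe_tanProj (x : Sph m) (z : Amb m) :
    (tanProj x z : Amb m) = z - ⟪(x : Amb m), z⟫ • (x : Amb m) := rfl

theorem inner_tanProj (x : Sph m) (v : Tan x) (z : Amb m) :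
    ⟪tanProj x z, v⟫ = ⟪(v : Amb m), z⟫ := by
  rw [Submodule.coe_inner, coe_tanProj, inner_sub_left, real_inner_smul_left, inner_tan,
    real_inner_comm]; simp

theorem norm_tanProj (x y : Sph m) :
    ‖tanProj x (y : Amb m)‖ = √(1 - ⟪(x : Amb m), (y : Amb m)⟫ ^ 2) := by
  have h : ‖tanProj x (y : Amb m)‖ ^ 2 = 1 - ⟪(x : Amb m), (y : Amb m)⟫ ^ 2 := by
    rw [← real_inner_self_eq_norm_sq, inner_tanProj, coe_tanProj, inner_sub_left,
      real_inner_smul_left, inner_self_sph]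
    ring
  rw [← h, Real.sqrt_sq (norm_nonneg _)]

theorem inner_expVec (x : Sph m) (v : Tan x) (z : Amb m) :
    ⟪expVec x v, z⟫ = Real.cos ‖v‖ * ⟪(x : Amb m), z⟫ + Real.sinc ‖v‖ * ⟪tanProj x z, v⟫ := by
  rw [inner_tanProj, expVec, inner_add_left, real_inner_smul_left, real_inner_smul_left]

@[simp] theorem coe_sphExp (x : Sph m) (v : Tan x) : (sphExp x v : Amb m) = expVec x v := rfl

theorem expVec_zero (x : Sph m) : expVec x 0 = (x : Amb m) := by simp [expVec]

theorem sphExp_zero (x : Sph m) : sphExp x 0 = x := Subtype.ext (expVec_zero x)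

theorem continuous_expVec (x : Sph m) : Continuous (expVec x) := by
  unfold expVec
  have := Real.continuous_sinc
  fun_prop

theorem continuous_sphExp (x : Sph m) : Continuous (sphExp x) :=
  (continuous_expVec x).subtype_mk _

theorem inner_left_expVec (x : Sph m) (v : Tan x) : ⟪(x : Amb m), expVec x v⟫ = Real.cos ‖v‖ := by
  rw [real_inner_comm, inner_expVec, inner_self_sph, inner_tanProj, real_inner_comm, inner_tan]
  ring

theorem sinc_mul_self (r : ℝ) : Real.sinc r * r = Real.sin r := by
  by_cases h : r = 0
  · simp [h]
  · rw [Real.sinc_of_ne_zero h]; field_simp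

/-- The geodesic with initial velocity `ξ`, parametrized over the whole line. -/
theorem expVec_smul (x : Sph m) (ξ : Tan x) (s : ℝ) :
    expVec x (s • ξ) = Real.cos (‖ξ‖ * s) • (x : Amb m)
      + Real.sin (‖ξ‖ * s) • (‖ξ‖⁻¹ • (ξ : Amb m)) := by
  by_cases hξ : ξ = 0
  · subst hξ
    simp only [smul_zero, expVec_zero, norm_zero, zero_mul, Real.cos_zero, one_smul,
      Real.sin_zero, zero_smul, add_zero]
  have hk : ‖ξ‖ ≠ 0 := norm_ne_zero_iff.2 hξ
  have hn : ‖s • ξ‖ = |‖ξ‖ * s| := by rw [norm_smul, Real.norm_eq_abs, abs_mul, abs_norm, mul_comm]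
  have hs : Real.sinc |‖ξ‖ * s| = Real.sinc (‖ξ‖ * s) := by
    rcases abs_choice (‖ξ‖ * s) with h | h <;> rw [h]
    rw [Real.sinc_neg]
  rw [expVec, hn, Real.cos_abs, hs, Submodule.coe_smul, smul_smul, smul_smul, ← sinc_mul_self]
  congr 2
  field_simp

/-- The differential of `exp_x` at `0` is the inclusion of the tangent space, tested against `z`. -/
theorem hasFDerivAt_inner_expVec (x : Sph m) (z : Amb m) :
    HasFDerivAt (fun v : Tan x => ⟪expVec x v, z⟫) (innerSL ℝ (tanProj x z)) 0 := by
  simp only [inner_expVec]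
  have h1 : HasFDerivAt (fun v : Tan x => Real.cos ‖v‖ - 1) (0 : Tan x →L[ℝ] ℝ) 0 := by
    refine Asymptotics.IsBigO.hasFDerivAt (n := 2) ?_ (by norm_num)
    refine Asymptotics.IsBigO.of_bound 1 (Eventually.of_forall fun v => ?_)
    have h := Real.one_sub_sq_div_two_le_cos (x := ‖v‖)
    have h' := Real.cos_le_one ‖v‖
    rw [Real.norm_eq_abs, abs_of_nonpos (by linarith)]
    simp only [sub_zero, norm_pow, norm_norm]
    nlinarith [sq_nonneg ‖v‖]
  have h2 : HasFDerivAt (fun v : Tan x => (Real.sinc ‖v‖ - 1) * ⟪tanProj x z, v⟫)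
      (0 : Tan x →L[ℝ] ℝ) 0 := by
    rw [hasFDerivAt_iff_isLittleO_nhds_zero]
    simp only [zero_add, norm_zero, Real.sinc_zero, sub_self, zero_mul, sub_zero,
      zero_apply]
    have ha : (fun v : Tan x => Real.sinc ‖v‖ - 1) =o[𝓝 0] (fun _ => (1 : ℝ)) := by
      rw [Asymptotics.isLittleO_one_iff]
      have := (Real.continuous_sinc.comp (continuous_norm (E := Tan x))).tendsto 0
      simp only [Function.comp_apply, norm_zero, Real.sinc_zero] at this
      simpa using this.sub_const 1
    have hb : (fun v : Tan x => ⟪tanProj x z, v⟫) =O[𝓝 0] (fun v => v) :=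
      (innerSL ℝ (tanProj x z)).isBigO_id _
    refine (Asymptotics.isLittleO_norm_right).1 ?_
    simpa only [one_mul] using ha.mul_isBigO hb.norm_right
  have h3 := (((h1.mul_const ⟪(x : Amb m), z⟫).add h2).add
    ((innerSL ℝ (tanProj x z)).hasFDerivAt (x := 0))).add_const ⟪(x : Amb m), z⟫
  refine (h3.congr_of_eventuallyEq (Eventually.of_forall fun v => ?_)).congr_fderiv (by simp)
  simp only [Pi.add_apply, innerSL_apply_apply]
  ring

end Sphere

/-! ### The momentum of the cost, and what A1 and A2 say about the profile -/

section Cost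

variable {m : ℕ} {f : ℝ → ℝ}

theorem radialCost_comm (x y : Sph m) : radialCost f x y = radialCost f y x := by
  rw [radialCost, radialCost, sphDist_comm]

theorem cosProfile_inner (x y : Sph m) :
    cosProfile f ⟪(x : Amb m), (y : Amb m)⟫ = f (sphDist x y) := by
  rcases (inner_sph_le_one x y).lt_or_eq with h1 | h1
  · simp [cosProfile, h1, sphDist]
  · simp [cosProfile, h1, sphDist]

theorem radialCost_eq {x y : Sph m} (h : y ≠ -x) :
    radialCost f x y = (cosProfile f ⟪(x : Amb m), (y : Amb m)⟫ : EReal) := by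
  rw [cosProfile_inner, radialCost, extendPi, if_pos (sphDist_mem_Ico h).2]

theorem toReal_radialCost {x y : Sph m} (h : y ≠ -x) :
    (radialCost f x y).toReal = cosProfile f ⟪(x : Amb m), (y : Amb m)⟫ := by
  rw [radialCost_eq h, EReal.toReal_coe]

/-- The covector `-∇ₓ c(x,y)`, by its explicit formula `M(⟪x,y⟫) (y - ⟪x,y⟫ x)`. -/
def momentum (f : ℝ → ℝ) (x y : Sph m) : Tan x :=
  radialFactor f ⟪(x : Amb m), (y : Amb m)⟫ • tanProj x (y : Amb m)

theorem coe_momentum (x y : Sph m) :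
    (momentum f x y : Amb m) = radialFactor f ⟪(x : Amb m), (y : Amb m)⟫ •
      ((y : Amb m) - ⟪(x : Amb m), (y : Amb m)⟫ • (x : Amb m)) := rfl

theorem eventually_sphExp_ne_neg {x y : Sph m} (h : y ≠ -x) :
    ∀ᶠ v : Tan x in 𝓝 0, y ≠ -sphExp x v := by
  have h1 : ContinuousAt (fun v : Tan x => ⟪expVec x v, (y : Amb m)⟫) 0 :=
    ((continuous_expVec x).inner continuous_const).continuousAt
  have h2 : -1 < ⟪expVec x 0, (y : Amb m)⟫ := by
    rw [expVec_zero]; exact neg_one_lt_inner_iff.2 h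
  filter_upwards [h1.eventually (lt_mem_nhds h2)] with v hv
  exact neg_one_lt_inner_iff.1 hv

theorem momentum_self (x : Sph m) : momentum f x x = 0 := by
  ext1; rw [coe_momentum, inner_self_sph]; simp

theorem sphDist_sphExp {x : Sph m} {v : Tan x} (hv : ‖v‖ ≤ Real.pi) :
    sphDist x (sphExp x v) = ‖v‖ := by
  rw [sphDist, coe_sphExp, inner_left_expVec, Real.arccos_cos (norm_nonneg _) hv]

theorem sphExp_ne_neg {x : Sph m} {v : Tan x} (hv : ‖v‖ < Real.pi) : sphExp x v ≠ -x := by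
  intro h
  have := sphDist_sphExp hv.le
  rw [h, sphDist_neg] at this
  exact hv.ne this.symm

theorem tanProj_expVec (x : Sph m) (v : Tan x) :
    tanProj x (expVec x v) = Real.sinc ‖v‖ • v := by
  ext1
  rw [coe_tanProj, inner_left_expVec, expVec, Submodule.coe_smul]
  simp

theorem momentum_sphExp {x : Sph m} {v : Tan x} (hv : ‖v‖ < Real.pi) :
    momentum f x (sphExp x v) = (profDeriv f ‖v‖ / ‖v‖) • v := by
  rcases (norm_nonneg v).eq_or_lt with h0 | h0
  · rw [norm_eq_zero.1 h0.symm, sphExp_zero, momentum_self, smul_zero]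
  have hs := Real.sin_pos_of_pos_of_lt_pi h0 hv
  have hc : Real.cos ‖v‖ < 1 := by
    rw [← Real.cos_zero]
    exact Real.strictAntiOn_cos ⟨le_rfl, Real.pi_pos.le⟩ ⟨h0.le, hv.le⟩ h0
  rw [momentum, coe_sphExp, tanProj_expVec, inner_left_expVec, radialFactor, if_pos hc,
    Real.arccos_cos h0.le hv.le, smul_smul, ← Real.abs_sin_eq_sqrt_one_sub_cos_sq,
    abs_of_pos hs, Real.sinc_of_ne_zero h0.ne']
  congr 1
  field_simp

namespace IsProfile

variable (hf : IsProfile f)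
include hf

theorem hasFDerivAt_radialCost {x y : Sph m} (h : y ≠ -x) :
    HasFDerivAt (fun v : Tan x => (radialCost f (sphExp x v) y).toReal)
      (innerSL ℝ (-momentum f x y)) 0 := by
  have h0 : HasDerivAt (cosProfile f) (-radialFactor f ⟪(x : Amb m), (y : Amb m)⟫)
      ⟪expVec x 0, (y : Amb m)⟫ := by
    rw [expVec_zero]; exact hf.hasDerivAt_cosProfile (neg_one_lt_inner_iff.2 h)
  have h1 := h0.comp_hasFDerivAt (0 : Tan x) (hasFDerivAt_inner_expVec x (y : Amb m))
  refine (h1.congr_of_eventuallyEq ?_).congr_fderiv ?_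
  · filter_upwards [eventually_sphExp_ne_neg h] with v hv
    simp [toReal_radialCost hv]
  · ext v
    simp [momentum]

theorem gradX_radialCost {x y : Sph m} (h : y ≠ -x) :
    gradX (radialCost f) x y = -momentum f x y := by
  refine HasGradientAt.gradient ?_
  rw [hasGradientAt_iff_hasFDerivAt]
  exact hf.hasFDerivAt_radialCost h

theorem neg_gradX_radialCost {x y : Sph m} (h : y ≠ -x) :
    -gradX (radialCost f) x y = momentum f x y := by
  rw [hf.gradX_radialCost h, neg_neg]

theorem radialFactor_nonneg {u : ℝ} (h' : u < 1) : 0 ≤ radialFactor f u := by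
  rw [radialFactor, if_pos h']
  exact div_nonneg (hf.profDeriv_nonneg _) (Real.sqrt_nonneg _)

theorem norm_momentum {x y : Sph m} (h : y ≠ -x) :
    ‖momentum f x y‖ = profDeriv f (sphDist x y) := by
  by_cases hxy : x = y
  · subst hxy; rw [momentum_self, sphDist_self, hf.zero, norm_zero]
  have hu := neg_one_lt_inner_iff.2 h
  have hu' := inner_sph_lt_one_iff.2 hxy
  rw [momentum, norm_smul, norm_tanProj, Real.norm_of_nonneg (hf.radialFactor_nonneg hu'),
    hf.radialFactor_mul_sqrt hu hu'.le, sphDist]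

/-- The sphere is a union of rays: `r ↦ exp_x (r e)` has momentum `f'(r) e`. -/
theorem momentum_ray {x : Sph m} {e : Tan x} (he : ‖e‖ = 1) {r : ℝ} (hr : r ∈ Set.Ico 0 Real.pi) :
    momentum f x (sphExp x (r • e)) = profDeriv f r • e := by
  have hn : ‖r • e‖ = r := by rw [norm_smul, he, mul_one, Real.norm_of_nonneg hr.1]
  rw [momentum_sphExp (by rw [hn]; exact hr.2), hn, smul_smul]
  rcases hr.1.eq_or_lt with h | h
  · simp [← h, hf.zero]
  · rw [div_mul_cancel₀ _ h.ne']

theorem exists_momentum_eq (hm : 1 ≤ m) (x : Sph m) {p : Tan x} {r : ℝ}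
    (hr : r ∈ Set.Ico 0 Real.pi) (hp : ‖p‖ = profDeriv f r) :
    ∃ y : Sph m, y ≠ -x ∧ sphDist x y = r ∧ momentum f x y = p := by
  obtain ⟨e, he, hpe⟩ : ∃ e : Tan x, ‖e‖ = 1 ∧ p = ‖p‖ • e := by
    by_cases h : p = 0
    · obtain ⟨e, he⟩ := exists_unit_tangent hm x
      exact ⟨e, he, by simp [h]⟩
    · have hn := norm_ne_zero_iff.2 h
      refine ⟨‖p‖⁻¹ • p, ?_, ?_⟩
      · rw [norm_smul, norm_inv, norm_norm, inv_mul_cancel₀ hn]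
      · rw [smul_smul, mul_inv_cancel₀ hn, one_smul]
  have hn : ‖r • e‖ = r := by rw [norm_smul, he, mul_one, Real.norm_of_nonneg hr.1]
  refine ⟨sphExp x (r • e), sphExp_ne_neg (by rw [hn]; exact hr.2), ?_, ?_⟩
  · rw [sphDist_sphExp (by rw [hn]; exact hr.2.le), hn]
  · rw [hf.momentum_ray he hr, ← hp, ← hpe]

end IsProfile

/-- A profile whose derivative is strictly increasing, with positive second derivative in the
interior. For the cost `f ∘ d` this is what A1 and A2 amount to. -/
structure IsConvexProfile (f : ℝ → ℝ) : Prop extends IsProfile f where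
  strictMono : StrictMonoOn (profDeriv f) (Set.Ico 0 Real.pi)
  second_pos : ∀ r ∈ Set.Ioo 0 Real.pi, 0 < profDeriv2 f r

/-- A1, restricted to a ray from `x`, says that `f'` is injective. -/
theorem IsProfile.strictMonoOn_profDeriv (hm : 1 ≤ m) (hf : IsProfile f)
    (hA1 : CondA1 (radialCost f : Sph m → Sph m → EReal)) :
    StrictMonoOn (profDeriv f) (Set.Ico 0 Real.pi) := by
  have hinj : Set.InjOn (profDeriv f) (Set.Ico 0 Real.pi) := by
    intro r hr s hs hrs
    obtain ⟨x⟩ : Nonempty (Sph m) := ⟨⟨EuclideanSpace.single 0 1, by simp⟩⟩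
    obtain ⟨e, he⟩ := exists_unit_tangent hm x
    have hn : ∀ t ∈ Set.Ico 0 Real.pi, ‖t • e‖ = t := fun t ht => by
      rw [norm_smul, he, mul_one, Real.norm_of_nonneg ht.1]
    have hne : ∀ t ∈ Set.Ico 0 Real.pi, sphExp x (t • e) ≠ -x := fun t ht =>
      sphExp_ne_neg (by rw [hn t ht]; exact ht.2)
    have h : sphExp x (r • e) = sphExp x (s • e) := hA1 x (hne r hr) (hne s hs) (by
      change -gradX (radialCost f) x (sphExp x (r • e)) = -gradX (radialCost f) x (sphExp x (s • e))
      rw [hf.neg_gradX_radialCost (hne r hr), hf.neg_gradX_radialCost (hne s hs),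
        hf.momentum_ray he hr, hf.momentum_ray he hs, hrs])
    have h2 := congrArg (sphDist x) h
    rwa [sphDist_sphExp (by rw [hn r hr]; exact hr.2.le),
      sphDist_sphExp (by rw [hn s hs]; exact hs.2.le), hn r hr, hn s hs] at h2
  intro r hr s hs hrs
  have hsub : Set.Icc 0 s ⊆ Set.Ico 0 Real.pi := fun t ht => ⟨ht.1, ht.2.trans_lt hs.2⟩
  exact (hf.contDiffOn_profDeriv.continuousOn.mono hsub).strictMonoOn_of_injOn_Icc hs.1
    (by rw [hf.zero]; exact hf.profDeriv_nonneg s) (hinj.mono hsub) ⟨hr.1, hrs.le⟩ ⟨hs.1, le_rfl⟩ hrs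

/-- The mixed Hessian maps the velocity of the geodesic from `x` to `y` to `-f''` times its initial
velocity, so that A2 excludes zeros of `f''`. -/
theorem IsProfile.profDeriv2_ne_zero (hm : 1 ≤ m) (hf : IsProfile f)
    (hA2 : CondA2 (radialCost f : Sph m → Sph m → EReal)) {r : ℝ} (hr : r ∈ Set.Ioo 0 Real.pi) :
    profDeriv2 f r ≠ 0 := by
  intro hzero
  obtain ⟨x⟩ : Nonempty (Sph m) := ⟨⟨EuclideanSpace.single 0 1, by simp⟩⟩
  obtain ⟨e, he⟩ := exists_unit_tangent hm x
  have hn : ∀ t ∈ Set.Ioo 0 Real.pi, ‖t • e‖ = t := fun t ht => by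
    rw [norm_smul, he, mul_one, Real.norm_of_nonneg ht.1.le]
  have hexp : ∀ t ∈ Set.Ioo 0 Real.pi, expVec x (t • e)
      = Real.cos t • (x : Amb m) + Real.sin t • (e : Amb m) := fun t ht => by
    rw [expVec, hn t ht, Submodule.coe_smul, smul_smul, sinc_mul_self]
  have hne : ∀ t ∈ Set.Ioo 0 Real.pi, sphExp x (t • e) ≠ -x := fun t ht =>
    sphExp_ne_neg (by rw [hn t ht]; exact ht.2)
  set y := sphExp x (r • e) with hy
  have hee : ⟪(e : Amb m), (e : Amb m)⟫ = 1 := by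
    rw [← Submodule.coe_inner, real_inner_self_eq_norm_sq, he]; norm_num
  have hxe := inner_tan x e
  -- `d` is the velocity at `y` of the geodesic from `x` through `y`
  let d : Tan y := ⟨-Real.sin r • (x : Amb m) + Real.cos r • (e : Amb m), by
    rw [Submodule.mem_orthogonal_singleton_iff_inner_right, hy, coe_sphExp, hexp r hr]
    simp only [inner_add_left, inner_add_right, real_inner_smul_left, real_inner_smul_right,
      inner_self_sph, hee, hxe, real_inner_comm (x : Amb m) (e : Amb m)]
    ring⟩
  have hd : ‖d‖ = 1 := by
    have : ‖d‖ ^ 2 = 1 := by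
      rw [← real_inner_self_eq_norm_sq, Submodule.coe_inner]
      simp only [d, inner_add_left, inner_add_right, real_inner_smul_left, real_inner_smul_right,
        inner_self_sph, hee, hxe, real_inner_comm (x : Amb m) (e : Amb m)]
      nlinarith [Real.sin_sq_add_cos_sq r]
    nlinarith [norm_nonneg d]
  have hgeo : ∀ s, 0 ≤ s → r + s ∈ Set.Ioo 0 Real.pi →
      sphExp y (s • d) = sphExp x ((r + s) • e) := by
    intro s hs hrs
    refine Subtype.ext ?_
    rw [coe_sphExp, coe_sphExp, hexp _ hrs, expVec, norm_smul, hd, mul_one,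
      Real.norm_of_nonneg hs, Submodule.coe_smul, smul_smul, sinc_mul_self,
      show (y : Amb m) = _ from hexp r hr, Real.cos_add, Real.sin_add]
    simp only [d]
    module
  have hker : mixedHess (radialCost f) x y d = 0 := by
    by_cases hdiff : DifferentiableAt ℝ (fun w : Tan y => gradX (radialCost f) x (sphExp y w)) 0
    · have h0 : HasFDerivAt (fun w : Tan y => gradX (radialCost f) x (sphExp y w))
          (mixedHess (radialCost f) x y) ((0 : ℝ) • d) := by
        rw [zero_smul]; exact hdiff.hasFDerivAt
      have h1 : HasDerivAt (fun s : ℝ => gradX (radialCost f) x (sphExp y (s • d)))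
          (mixedHess (radialCost f) x y d) 0 := by
        have h3 : HasDerivAt (fun s : ℝ => s • d) d 0 := by
          simpa using (hasDerivAt_id (0 : ℝ)).smul_const d
        exact h0.comp_hasDerivAt 0 h3
      have h2 : HasDerivAt (fun s : ℝ => -(profDeriv f (r + s) • e)) (-(profDeriv2 f r • e)) 0 := by
        have h4 : HasDerivAt (fun s : ℝ => profDeriv f (r + s)) (profDeriv2 f r) 0 := by
          refine HasDerivAt.comp_const_add (f := profDeriv f) r 0 ?_
          rw [add_zero]; exact hf.hasDerivAt_profDeriv hr
        exact (h4.smul_const e).neg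
      have h5 : HasDerivWithinAt (fun s : ℝ => -(profDeriv f (r + s) • e))
          (mixedHess (radialCost f) x y d) (Set.Ici 0) 0 := by
        refine h1.hasDerivWithinAt.congr_of_eventuallyEq_of_mem ?_ Set.self_mem_Ici
        have hlt : ∀ᶠ s in 𝓝[≥] (0 : ℝ), s < Real.pi - r :=
          mem_nhdsWithin_of_mem_nhds (Iio_mem_nhds (by linarith [hr.2]))
        filter_upwards [self_mem_nhdsWithin, hlt] with s hs hs'
        have hrs : r + s ∈ Set.Ioo 0 Real.pi :=
          ⟨by linarith [hr.1, show (0 : ℝ) ≤ s from hs], by linarith⟩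
        rw [hgeo s hs hrs, hf.gradX_radialCost (hne _ hrs),
          hf.momentum_ray he (Ioo_pi_sub_Ico hrs)]
      rw [(uniqueDiffWithinAt_Ici 0).eq_deriv _ h5 h2.hasDerivWithinAt, hzero]
      simp
    -- otherwise the derivative is zero by convention
    · rw [mixedHess, fderiv_zero_of_not_differentiableAt hdiff]; simp
  have hdet := hA2 x y (hne r hr)
    (OrthonormalBasis.fromOrthogonalSpanSingleton m (sph_ne_zero x))
    (OrthonormalBasis.fromOrthogonalSpanSingleton m (sph_ne_zero y))
  have hv := Matrix.eq_zero_of_mulVec_eq_zero hdet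
    ((LinearMap.toMatrix_mulVec_repr _ _ _ d).trans (by
      rw [ContinuousLinearMap.coe_coe, hker, map_zero]; rfl))
  have hd0 : d = 0 := by
    apply (OrthonormalBasis.fromOrthogonalSpanSingleton m (sph_ne_zero y)).toBasis.repr.injective
    rw [map_zero]; exact DFunLike.coe_injective hv
  rw [hd0, norm_zero] at hd
  exact zero_ne_one hd

theorem IsProfile.isConvexProfile (hm : 1 ≤ m) (hf : IsProfile f)
    (hA1 : CondA1 (radialCost f : Sph m → Sph m → EReal))
    (hA2 : CondA2 (radialCost f : Sph m → Sph m → EReal)) : IsConvexProfile f where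
  toIsProfile := hf
  strictMono := hf.strictMonoOn_profDeriv hm hA1
  second_pos _ hr := lt_of_le_of_ne
    ((hf.strictMonoOn_profDeriv hm hA1).monotoneOn.derivWithin_nonneg)
    (hf.profDeriv2_ne_zero hm hA2 hr).symm

end Cost

/-! ### Second derivatives along curves -/

section SecondDerivative

variable {E : Type*} [NormedAddCommGroup E] [NormedSpace ℝ E]

/-- `h` is differentiable near `t`, with derivative `b` at `t`, and its derivative is
differentiable at `t`, with derivative `c`. -/
def HasSecondDerivAt (h : ℝ → E) (b c : E) (t : ℝ) : Prop :=
  ∃ h' : ℝ → E, (∀ᶠ s in 𝓝 t, HasDerivAt h (h' s) s) ∧ h' t = b ∧ HasDerivAt h' c t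

namespace HasSecondDerivAt

variable {h k : ℝ → E} {b c b₁ c₁ : E} {t : ℝ}

theorem hasDerivAt (H : HasSecondDerivAt h b c t) : HasDerivAt h b t := by
  obtain ⟨h', h1, rfl, -⟩ := H
  exact h1.self_of_nhds

theorem continuousAt (H : HasSecondDerivAt h b c t) : ContinuousAt h t :=
  H.hasDerivAt.continuousAt

theorem deriv_eventuallyEq {h' : ℝ → E} (h1 : ∀ᶠ s in 𝓝 t, HasDerivAt h (h' s) s) :
    deriv h =ᶠ[𝓝 t] h' := h1.mono fun _ hs => hs.deriv

theorem deriv_deriv (H : HasSecondDerivAt h b c t) : deriv (deriv h) t = c := by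
  obtain ⟨h', h1, rfl, h2⟩ := H
  exact ((deriv_eventuallyEq h1).deriv_eq).trans h2.deriv

theorem iteratedDeriv_two (H : HasSecondDerivAt h b c t) : iteratedDeriv 2 h t = c := by
  rw [iteratedDeriv_succ, iteratedDeriv_one, H.deriv_deriv]

theorem unique (H : HasSecondDerivAt h b c t) (H₁ : HasSecondDerivAt h b₁ c₁ t) :
    b = b₁ ∧ c = c₁ :=
  ⟨H.hasDerivAt.unique H₁.hasDerivAt, H.deriv_deriv.symm.trans H₁.deriv_deriv⟩

theorem congr (H : HasSecondDerivAt h b c t) (e : k =ᶠ[𝓝 t] h) : HasSecondDerivAt k b c t := by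
  obtain ⟨h', h1, h2, h3⟩ := H
  refine ⟨h', ?_, h2, h3⟩
  filter_upwards [h1, e.eventuallyEq_nhds] with s hs es
  exact hs.congr_of_eventuallyEq es

theorem const (a : E) (t : ℝ) : HasSecondDerivAt (fun _ => a) 0 0 t :=
  ⟨fun _ => 0, Eventually.of_forall fun s => hasDerivAt_const s a, rfl, hasDerivAt_const t 0⟩

theorem sub (H : HasSecondDerivAt h b c t) (H₁ : HasSecondDerivAt k b₁ c₁ t) :
    HasSecondDerivAt (fun s => h s - k s) (b - b₁) (c - c₁) t := by
  obtain ⟨h', h1, rfl, h2⟩ := H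
  obtain ⟨k', k1, rfl, k2⟩ := H₁
  refine ⟨fun s => h' s - k' s, ?_, rfl, h2.sub k2⟩
  filter_upwards [h1, k1] with s hs ks
  exact hs.sub ks

theorem mul {h k : ℝ → ℝ} {b c b₁ c₁ : ℝ} (H : HasSecondDerivAt h b c t)
    (H₁ : HasSecondDerivAt k b₁ c₁ t) :
    HasSecondDerivAt (fun s => h s * k s) (b * k t + h t * b₁)
      (c * k t + 2 * b * b₁ + h t * c₁) t := by
  have hd := H.hasDerivAt
  have kd := H₁.hasDerivAt
  obtain ⟨h', h1, rfl, h2⟩ := H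
  obtain ⟨k', k1, rfl, k2⟩ := H₁
  refine ⟨fun s => h' s * k s + h s * k' s, ?_, rfl,
    ((h2.mul kd).add (hd.mul k2)).congr_deriv (by ring)⟩
  filter_upwards [h1, k1] with s hs ks
  exact hs.mul ks

theorem comp {φ h : ℝ → ℝ} {β γ b c : ℝ} (H : HasSecondDerivAt φ β γ (h t))
    (H₁ : HasSecondDerivAt h b c t) :
    HasSecondDerivAt (fun s => φ (h s)) (β * b) (γ * b ^ 2 + β * c) t := by
  have hd := H₁.hasDerivAt
  obtain ⟨φ', φ1, rfl, φ2⟩ := H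
  obtain ⟨h', h1, rfl, h2⟩ := H₁
  refine ⟨fun s => φ' (h s) * h' s, ?_, rfl, ((φ2.comp t hd).mul h2).congr_deriv ?_⟩
  · filter_upwards [h1, hd.continuousAt.eventually φ1] with s hs φs
    exact φs.comp s hs
  · simp only [Function.comp]; ring

theorem of_contDiffAt (H : ContDiffAt ℝ 2 h t) :
    HasSecondDerivAt h (deriv h t) (deriv (deriv h) t) t := by
  refine ⟨deriv h, ?_, rfl, ?_⟩
  · filter_upwards [H.eventually (by simp)] with s hs
    exact (hs.differentiableAt (by simp)).hasDerivAt
  · have h1 : ContDiffAt ℝ 1 (fderiv ℝ h) t := H.fderiv_right (m := 1) (by norm_num)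
    have h2 : ContDiffAt ℝ 1 (fun s => fderiv ℝ h s 1) t := h1.clm_apply contDiffAt_const
    exact (h2.differentiableAt (by simp)).hasDerivAt

theorem inner {V : Type*} [NormedAddCommGroup V] [InnerProductSpace ℝ V] {h k : ℝ → V}
    {b c b₁ c₁ : V} (H : HasSecondDerivAt h b c t) (H₁ : HasSecondDerivAt k b₁ c₁ t) :
    HasSecondDerivAt (fun s => ⟪h s, k s⟫) (⟪b, k t⟫ + ⟪h t, b₁⟫)
      (⟪c, k t⟫ + 2 * ⟪b, b₁⟫ + ⟪h t, c₁⟫) t := by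
  have hd := H.hasDerivAt
  have kd := H₁.hasDerivAt
  obtain ⟨h', h1, rfl, h2⟩ := H
  obtain ⟨k', k1, rfl, k2⟩ := H₁
  refine ⟨fun s => ⟪h' s, k s⟫ + ⟪h s, k' s⟫, ?_, rfl,
    ((h2.inner ℝ kd).add (hd.inner ℝ k2)).congr_deriv (by ring)⟩
  filter_upwards [h1, k1] with s hs ks
  exact (hs.inner ℝ ks).congr_deriv (by ring)

theorem inner_const {V : Type*} [NormedAddCommGroup V] [InnerProductSpace ℝ V] {h : ℝ → V}
    {b c : V} (H : HasSecondDerivAt h b c t) (z : V) :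
    HasSecondDerivAt (fun s => ⟪z, h s⟫) ⟪z, b⟫ ⟪z, c⟫ t := by
  simpa using (const z t).inner H

/-- The second-order necessary condition for a local maximum. -/
theorem of_isLocalMax {h : ℝ → ℝ} {b c : ℝ} (H : HasSecondDerivAt h b c t) (hm : IsLocalMax h t) :
    b = 0 ∧ c ≤ 0 := by
  have hb : b = 0 := hm.hasDerivAt_eq_zero H.hasDerivAt
  refine ⟨hb, le_of_not_gt fun hc => ?_⟩
  have h1 : IsLocalMin h t := isLocalMin_of_deriv_deriv_pos (by rwa [H.deriv_deriv])
    (by rw [H.hasDerivAt.deriv, hb]) H.continuousAt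
  have h2 : h =ᶠ[𝓝 t] fun _ => h t := by
    filter_upwards [h1, hm] with s hs hs'
    exact le_antisymm hs' hs
  exact hc.ne (((const (h t) t).congr h2).unique H).2

end HasSecondDerivAt

/-- A product is differentiable at a zero of a differentiable factor as soon as the other factor is
continuous there. -/
theorem hasDerivAt_mul_of_continuousAt {a b : ℝ → ℝ} {b' t : ℝ} (ha : ContinuousAt a t)
    (hb : HasDerivAt b b' t) (hbt : b t = 0) :
    HasDerivAt (fun s => a s * b s) (a t * b') t := by
  rw [hasDerivAt_iff_tendsto_slope] at hb ⊢
  refine ((ha.tendsto.mono_left nhdsWithin_le_nhds).mul hb).congr' ?_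
  filter_upwards with s
  simp only [slope_def_field, hbt]
  ring

/-- Second derivative of `F ∘ u`. At `u = 1`, where `F` is only `C¹`, the derivative of `u` is
required to vanish. -/
theorem IsProfile.hasSecondDerivAt_cosProfile {f : ℝ → ℝ} (hf : IsProfile f) {u : ℝ → ℝ}
    {b c t : ℝ} (hu : HasSecondDerivAt u b c t) (h1 : -1 < u t) (h2 : u t < 1 ∨ b = 0) :
    HasSecondDerivAt (fun s => cosProfile f (u s)) (-(radialFactor f (u t) * b))
      (-(deriv (radialFactor f) (u t) * b ^ 2 + radialFactor f (u t) * c)) t := by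
  have hd := hu.hasDerivAt
  obtain ⟨u', hu1, rfl, hu2⟩ := hu
  refine ⟨fun s => -(radialFactor f (u s) * u' s), ?_, rfl, HasDerivAt.neg ?_⟩
  · filter_upwards [hu1, hd.continuousAt.eventually (lt_mem_nhds h1)] with s hs hs1
    exact ((hf.hasDerivAt_cosProfile hs1).comp s hs).congr_deriv (by ring)
  · by_cases h3 : u t < 1
    · have hM := ((hf.contDiffAt_radialFactor h1 h3).differentiableAt (by simp)).hasDerivAt
      refine ((hM.comp t hd).mul hu2).congr_deriv ?_
      simp only [Function.comp]; ring
    · have h0 := h2.resolve_left h3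
      refine (hasDerivAt_mul_of_continuousAt
        ((hf.continuousAt_radialFactor h1).comp hd.continuousAt) hu2 h0).congr_deriv ?_
      simp only [Function.comp, h0]; ring

end SecondDerivative

/-! ### Momenta fill a ball, and determine their points -/

section Inverse

variable {m : ℕ} {f : ℝ → ℝ}

/-- The radii of the momenta: the range of `f'` on `[0, π)`. -/
def momRange (f : ℝ → ℝ) : Set ℝ := profDeriv f '' Set.Ico 0 Real.pi

/-- The inverse of `f'` on `[0, π)`: the distance from `x` to the point of momentum `p` is
`invProfDeriv f ‖p‖`. -/
def invProfDeriv (f : ℝ → ℝ) : ℝ → ℝ := Function.invFunOn (profDeriv f) (Set.Ico 0 Real.pi)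

theorem IsProfile.norm_momentum_mem (hf : IsProfile f) {x y : Sph m} (h : y ≠ -x) :
    ‖momentum f x y‖ ∈ momRange f :=
  ⟨_, sphDist_mem_Ico h, (hf.norm_momentum h).symm⟩

theorem IsProfile.mem_momRange_of_le (hf : IsProfile f) {q q' : ℝ} (h0 : 0 ≤ q) (h : q ≤ q')
    (hq' : q' ∈ momRange f) : q ∈ momRange f := by
  obtain ⟨r, hr, rfl⟩ := hq'
  have hsub : Set.Icc 0 r ⊆ Set.Ico 0 Real.pi := fun t ht => ⟨ht.1, ht.2.trans_lt hr.2⟩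
  have hivt := intermediate_value_Icc hr.1 (hf.contDiffOn_profDeriv.continuousOn.mono hsub)
  rw [hf.zero] at hivt
  exact Set.image_mono hsub (hivt ⟨h0, h⟩)

/-- The momenta at `x` fill a ball, so that a segment between two momenta consists of momenta. -/
theorem IsProfile.norm_mem_momRange_of_mem_segment (hf : IsProfile f) {V : Type*}
    [NormedAddCommGroup V] [NormedSpace ℝ V] {p₀ p₁ p : V} (h₀ : ‖p₀‖ ∈ momRange f)
    (h₁ : ‖p₁‖ ∈ momRange f) (hp : p ∈ segment ℝ p₀ p₁) : ‖p‖ ∈ momRange f := by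
  have h2 : ‖p‖ ≤ max ‖p₀‖ ‖p₁‖ :=
    (convexOn_univ_norm (E := V)).le_on_segment (Set.mem_univ _) (Set.mem_univ _) hp
  refine hf.mem_momRange_of_le (norm_nonneg _) h2 ?_
  rcases max_choice ‖p₀‖ ‖p₁‖ with h | h <;> rw [h] <;> assumption

namespace IsConvexProfile

variable (hf : IsConvexProfile f)
include hf

theorem invProfDeriv_profDeriv {r : ℝ} (hr : r ∈ Set.Ico 0 Real.pi) :
    invProfDeriv f (profDeriv f r) = r :=
  hf.strictMono.injOn.leftInvOn_invFunOn hr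

theorem profDeriv_pos {r : ℝ} (hr : r ∈ Set.Ioo 0 Real.pi) : 0 < profDeriv f r := by
  rw [← hf.zero]; exact hf.strictMono zero_mem_Ico_pi (Ioo_pi_sub_Ico hr) hr.1

theorem radialFactor_pos {u : ℝ} (h : -1 < u) (h' : u < 1) : 0 < radialFactor f u := by
  rw [radialFactor, if_pos h']
  exact div_pos (hf.profDeriv_pos (arccos_mem_Ioo h h')) (Real.sqrt_pos.2 (one_sub_sq_pos h h'))

theorem exists_pos_of_mem_momRange {q : ℝ} (hq : q ∈ momRange f) (h0 : q ≠ 0) :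
    ∃ r ∈ Set.Ioo 0 Real.pi, profDeriv f r = q := by
  obtain ⟨r, hr, rfl⟩ := hq
  refine ⟨r, ⟨hr.1.lt_of_ne fun h => h0 ?_, hr.2⟩, rfl⟩
  rw [← h, hf.zero]

theorem eventually_mem_momRange {q : ℝ} (hq : q ∈ momRange f) :
    ∀ᶠ q' in 𝓝 q, 0 ≤ q' → q' ∈ momRange f := by
  obtain ⟨r, hr, rfl⟩ := hq
  obtain ⟨s, hrs, hs⟩ := exists_between hr.2
  have hs' : s ∈ Set.Ico 0 Real.pi := ⟨hr.1.trans hrs.le, hs⟩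
  filter_upwards [Iio_mem_nhds (hf.strictMono hr hs' hrs)] with q hq h0
  exact hf.mem_momRange_of_le h0 (le_of_lt hq) ⟨s, hs', rfl⟩

/-- The inverse of `f'` is smooth on the positive part of its domain, as `f'' > 0`. -/
theorem contDiffAt_invProfDeriv {r : ℝ} (hr : r ∈ Set.Ioo 0 Real.pi) :
    ContDiffAt ℝ ∞ (invProfDeriv f) (profDeriv f r) := by
  have h2 := (hf.second_pos r hr).ne'
  have hd : HasFDerivAt (profDeriv f)
      (ContinuousLinearEquiv.unitsEquivAut ℝ (Units.mk0 _ h2) : ℝ →L[ℝ] ℝ) r := by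
    refine (hf.hasDerivAt_profDeriv hr).hasFDerivAt.congr_fderiv ?_
    ext; simp
  have hc := hf.contDiffAt_profDeriv hr
  refine (hc.to_localInverse hd (by simp)).congr_of_eventuallyEq ?_
  have hst := hc.hasStrictFDerivAt' hd (by simp)
  have ht : Tendsto (hc.localInverse hd (by simp)) (𝓝 (profDeriv f r)) (𝓝 r) :=
    hst.localInverse_tendsto
  filter_upwards [hst.eventually_right_inverse, ht.eventually (Ioo_mem_nhds hr.1 hr.2)]
    with q hq hq'
  have h3 := hf.invProfDeriv_profDeriv (Ioo_pi_sub_Ico hq')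
  have h4 : profDeriv f (hc.localInverse hd (by simp) q) = q := hq
  rwa [h4] at h3

theorem hasDerivAt_invProfDeriv {r : ℝ} (hr : r ∈ Set.Ioo 0 Real.pi) :
    HasDerivAt (invProfDeriv f) (profDeriv2 f r)⁻¹ (profDeriv f r) := by
  have h1 := ((hf.contDiffAt_invProfDeriv hr).differentiableAt (by simp)).hasDerivAt
  have h2 := h1.comp r (hf.hasDerivAt_profDeriv hr)
  have h3 : HasDerivAt (invProfDeriv f ∘ profDeriv f) 1 r := by
    refine (hasDerivAt_id r).congr_of_eventuallyEq ?_
    filter_upwards [Ico_pi_mem_nhds hr] with s hs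
    exact hf.invProfDeriv_profDeriv hs
  refine h1.congr_deriv ?_
  exact eq_inv_of_mul_eq_one_left (h2.unique h3)

theorem tendsto_invProfDeriv_zero : Tendsto (invProfDeriv f) (𝓝[≥] 0) (𝓝 0) := by
  rw [Metric.tendsto_nhds]
  intro ε hε
  obtain ⟨s, hs0, hs⟩ := exists_between (lt_min hε Real.pi_pos)
  have hs' : s ∈ Set.Ioo 0 Real.pi := ⟨hs0, hs.trans_le (min_le_right _ _)⟩
  have hpos := hf.profDeriv_pos hs'
  filter_upwards [self_mem_nhdsWithin, mem_nhdsWithin_of_mem_nhds (Iio_mem_nhds hpos)] with q hq hq'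
  obtain ⟨r, hr, rfl⟩ := hf.mem_momRange_of_le hq (le_of_lt hq') ⟨s, Ioo_pi_sub_Ico hs', rfl⟩
  rw [hf.invProfDeriv_profDeriv hr, Real.dist_eq, sub_zero, abs_of_nonneg hr.1]
  exact ((hf.strictMono.lt_iff_lt hr (Ioo_pi_sub_Ico hs')).1 hq').trans
    (hs.trans_le (min_le_left _ _))

theorem invProfDeriv_norm_momentum {x y : Sph m} (h : y ≠ -x) :
    invProfDeriv f ‖momentum f x y‖ = sphDist x y := by
  rw [hf.norm_momentum h, hf.invProfDeriv_profDeriv (sphDist_mem_Ico h)]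

theorem momentum_injOn (x : Sph m) : Set.InjOn (momentum f x) {y | y ≠ -x} := by
  intro y hy z hz h
  have hd : ⟪(x : Amb m), (y : Amb m)⟫ = ⟪(x : Amb m), (z : Amb m)⟫ := by
    rw [← cos_sphDist, ← cos_sphDist, ← hf.invProfDeriv_norm_momentum hy, h,
      hf.invProfDeriv_norm_momentum hz]
  by_cases hxy : x = y
  · have h1 : ⟪(x : Amb m), (z : Amb m)⟫ = 1 := by rw [← hd]; exact inner_sph_eq_one_iff.2 hxy
    rw [← hxy, inner_sph_eq_one_iff.1 h1]
  · have hM := hf.radialFactor_pos (neg_one_lt_inner_iff.2 hy) (inner_sph_lt_one_iff.2 hxy)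
    have h2 := congrArg (Subtype.val) h
    rw [coe_momentum, coe_momentum, ← hd] at h2
    exact Subtype.ext (sub_left_injective (smul_right_injective _ hM.ne' h2))

theorem eq_of_momentum_eq_zero {x y : Sph m} (hy : y ≠ -x) (h : momentum f x y = 0) : x = y :=
  (hf.momentum_injOn x hy (self_ne_neg x) (by rw [h, momentum_self])).symm

theorem cExp_momentum {x y : Sph m} (hy : y ≠ -x) :
    cExp (radialCost f) x (momentum f x y) = y := by
  have hinj : Set.InjOn (fun y : Sph m => -gradX (radialCost f) x y) {y | (x, y) ∈ offAnti m} := by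
    refine (hf.momentum_injOn x).congr fun z hz => ?_
    exact (hf.neg_gradX_radialCost hz).symm
  have : Nonempty (Sph m) := ⟨x⟩
  have h := hinj.leftInvOn_invFunOn (show y ∈ {y | (x, y) ∈ offAnti m} from hy)
  rw [← hf.neg_gradX_radialCost hy]
  exact h

theorem exists_of_norm_mem (hm : 1 ≤ m) (x : Sph m) {p : Tan x} (hp : ‖p‖ ∈ momRange f) :
    ∃ y : Sph m, y ≠ -x ∧ momentum f x y = p := by
  obtain ⟨r, hr, hrp⟩ := hp
  obtain ⟨y, hy, -, h⟩ := hf.exists_momentum_eq hm x hr hrp.symm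
  exact ⟨y, hy, h⟩

end IsConvexProfile

end Inverse

/-! ### The Hessian of the cost as a function of the momentum -/

section Hessian

variable {m : ℕ} {f : ℝ → ℝ}

/-- The Hessian of `-c(·,y)` at `x` on the vector `ξ`, as a function of the momentum
`q = -∇ₓ c(x,y)`. -/
def hessForm (f : ℝ → ℝ) {x : Sph m} (q ξ : Tan x) : ℝ :=
  -(radialFactor f (Real.cos (invProfDeriv f ‖q‖)) * Real.cos (invProfDeriv f ‖q‖)) * ‖ξ‖ ^ 2
    + deriv (radialFactor f) (Real.cos (invProfDeriv f ‖q‖))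
      / radialFactor f (Real.cos (invProfDeriv f ‖q‖)) ^ 2 * ⟪q, ξ⟫ ^ 2

namespace IsConvexProfile

variable (hf : IsConvexProfile f)
include hf

theorem cos_invProfDeriv_norm_momentum {x y : Sph m} (h : y ≠ -x) :
    Real.cos (invProfDeriv f ‖momentum f x y‖) = ⟪(x : Amb m), (y : Amb m)⟫ := by
  rw [hf.invProfDeriv_norm_momentum h, cos_sphDist]

theorem hessForm_momentum {x y : Sph m} (h : y ≠ -x) (ξ : Tan x) :
    hessForm f (momentum f x y) ξ =
      -(radialFactor f ⟪(x : Amb m), (y : Amb m)⟫ * ⟪(x : Amb m), (y : Amb m)⟫) * ‖ξ‖ ^ 2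
        + deriv (radialFactor f) ⟪(x : Amb m), (y : Amb m)⟫ * ⟪(ξ : Amb m), (y : Amb m)⟫ ^ 2 := by
  rw [hessForm, hf.cos_invProfDeriv_norm_momentum h]
  congr 1
  by_cases hxy : x = y
  · subst hxy
    rw [momentum_self, inner_zero_left, real_inner_comm (x : Amb m) (ξ : Amb m), inner_tan]; simp
  · have hM := (hf.radialFactor_pos (neg_one_lt_inner_iff.2 h) (inner_sph_lt_one_iff.2 hxy)).ne'
    rw [momentum, real_inner_smul_left, inner_tanProj]
    field_simp

/-- In normal coordinates at `x`, the second derivative of `-c(·,y)` in the direction `ξ`. -/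
theorem iteratedDeriv_two_radialCost {x y : Sph m} (h : y ≠ -x) (ξ : Tan x) :
    iteratedDeriv 2 (fun s : ℝ => -(radialCost f (sphExp x (s • ξ)) y).toReal) 0
      = hessForm f (momentum f x y) ξ := by
  rw [hf.hessForm_momentum h]
  by_cases hξ : ξ = 0
  · subst hξ
    simp only [smul_zero, iteratedDeriv_const]
    simp
  set u := ⟪(x : Amb m), (y : Amb m)⟫ with hu
  set β := ⟪(ξ : Amb m), (y : Amb m)⟫ with hβ
  have hk : ‖ξ‖ ≠ 0 := norm_ne_zero_iff.2 hξ
  have hη : ∀ s : ℝ, ⟪expVec x (s • ξ), (y : Amb m)⟫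
      = Real.cos (‖ξ‖ * s) * u + Real.sin (‖ξ‖ * s) * (β / ‖ξ‖) := by
    intro s
    rw [expVec_smul, inner_add_left, real_inner_smul_left, real_inner_smul_left,
      real_inner_smul_left, inv_mul_eq_div]
  have hcos : ∀ s : ℝ, HasDerivAt (fun s => Real.cos (‖ξ‖ * s)) (-(Real.sin (‖ξ‖ * s) * ‖ξ‖)) s :=
    fun s => by
      have h3 : HasDerivAt (fun s => ‖ξ‖ * s) ‖ξ‖ s := by
        simpa using (hasDerivAt_id s).const_mul ‖ξ‖
      simpa using h3.cos
  have hsin : ∀ s : ℝ, HasDerivAt (fun s => Real.sin (‖ξ‖ * s)) (Real.cos (‖ξ‖ * s) * ‖ξ‖) s :=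
    fun s => by
      have h3 : HasDerivAt (fun s => ‖ξ‖ * s) ‖ξ‖ s := by
        simpa using (hasDerivAt_id s).const_mul ‖ξ‖
      simpa using h3.sin
  have hjet : HasSecondDerivAt (fun s : ℝ => ⟪expVec x (s • ξ), (y : Amb m)⟫) β
      (-(‖ξ‖ ^ 2 * u)) 0 := by
    simp only [hη]
    refine ⟨fun s => -(Real.sin (‖ξ‖ * s) * ‖ξ‖) * u + Real.cos (‖ξ‖ * s) * ‖ξ‖ * (β / ‖ξ‖),
      Eventually.of_forall fun s => ((hcos s).mul_const u).add ((hsin s).mul_const _), ?_, ?_⟩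
    · simp only [mul_zero, Real.sin_zero, Real.cos_zero, zero_mul, neg_zero, one_mul, zero_add]
      rw [mul_div_cancel₀ _ hk]
    · refine (((((hsin 0).mul_const ‖ξ‖).neg).mul_const u).add
        (((hcos 0).mul_const ‖ξ‖).mul_const _)).congr_deriv ?_
      simp only [mul_zero, Real.sin_zero, Real.cos_zero, zero_mul, neg_zero]
      ring
  have h0 : ⟪expVec x ((0 : ℝ) • ξ), (y : Amb m)⟫ = u := by rw [zero_smul, expVec_zero]
  have hF := (HasSecondDerivAt.const (0 : ℝ) 0).sub (hf.hasSecondDerivAt_cosProfile hjet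
    (by rw [h0]; exact neg_one_lt_inner_iff.2 h) (by
      rw [h0]
      by_cases hxy : x = y
      · right; rw [hβ, ← hxy, real_inner_comm, inner_tan]
      · left; exact inner_sph_lt_one_iff.2 hxy))
  have hev : (fun s : ℝ => -(radialCost f (sphExp x (s • ξ)) y).toReal) =ᶠ[𝓝 0]
      fun s => 0 - cosProfile f ⟪expVec x (s • ξ), (y : Amb m)⟫ := by
    have ht : Tendsto (fun s : ℝ => s • ξ) (𝓝 0) (𝓝 0) := by
      have : Continuous fun s : ℝ => s • ξ := by fun_prop
      simpa using this.tendsto 0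
    filter_upwards [ht.eventually (eventually_sphExp_ne_neg h)] with s hs
    rw [toReal_radialCost hs, coe_sphExp, zero_sub]
  rw [(hF.congr hev).iteratedDeriv_two, h0]
  ring

/-- The cost-sectional curvature is the second derivative of `hessForm` in the momentum. -/
theorem costCurv_eq (hm : 1 ≤ m) {x y : Sph m} (h : y ≠ -x) (ξ ν : Tan x) :
    costCurv (radialCost f) x y ξ ν
      = iteratedDeriv 2 (fun t : ℝ => hessForm f (momentum f x y + t • ν) ξ) 0 := by
  -- the perturbed momentum is still a momentum, so `cExp` takes no junk value
  have hev : ∀ᶠ t : ℝ in 𝓝 0, ‖momentum f x y + t • ν‖ ∈ momRange f := by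
    have hc : Continuous fun t : ℝ => ‖momentum f x y + t • ν‖ := by fun_prop
    have ht : Tendsto (fun t : ℝ => ‖momentum f x y + t • ν‖) (𝓝 0) (𝓝 ‖momentum f x y‖) := by
      simpa using hc.tendsto 0
    filter_upwards [ht.eventually (hf.eventually_mem_momRange (hf.norm_momentum_mem h))] with t ht
    exact ht (norm_nonneg _)
  refine Filter.EventuallyEq.iteratedDeriv_eq 2 ?_
  filter_upwards [hev] with t ht
  obtain ⟨z, hz, hzt⟩ := hf.exists_of_norm_mem hm x ht
  rw [hf.neg_gradX_radialCost h, ← hzt, hf.cExp_momentum hz, hf.iteratedDeriv_two_radialCost hz]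

theorem contDiffAt_cos_invProfDeriv_norm {V : Type*} [NormedAddCommGroup V]
    [InnerProductSpace ℝ V] {q : V} (hq : ‖q‖ ∈ momRange f) (h0 : q ≠ 0) :
    ContDiffAt ℝ ∞ (fun q : V => Real.cos (invProfDeriv f ‖q‖)) q := by
  obtain ⟨r, hr, hrq⟩ := hf.exists_pos_of_mem_momRange hq (norm_ne_zero_iff.2 h0)
  have h1 := hf.contDiffAt_invProfDeriv hr
  rw [hrq] at h1
  exact Real.contDiff_cos.contDiffAt.comp q (h1.comp q (contDiffAt_norm ℝ h0))

theorem cos_invProfDeriv_mem {q : ℝ} (hq : q ∈ momRange f) (h0 : q ≠ 0) :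
    Real.cos (invProfDeriv f q) ∈ Set.Ioo (-1) 1 := by
  obtain ⟨r, hr, rfl⟩ := hf.exists_pos_of_mem_momRange hq h0
  rw [hf.invProfDeriv_profDeriv (Ioo_pi_sub_Ico hr)]
  constructor
  · rw [← Real.cos_pi]
    exact Real.strictAntiOn_cos ⟨hr.1.le, hr.2.le⟩ ⟨Real.pi_pos.le, le_rfl⟩ hr.2
  · rw [← Real.cos_zero]
    exact Real.strictAntiOn_cos ⟨le_rfl, Real.pi_pos.le⟩ ⟨hr.1.le, hr.2.le⟩ hr.1

theorem invProfDeriv_zero : invProfDeriv f 0 = 0 := by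
  have h := hf.invProfDeriv_profDeriv zero_mem_Ico_pi
  rwa [hf.zero] at h

theorem contDiffAt_deriv_radialFactor {u : ℝ} (h : -1 < u) (h' : u < 1) :
    ContDiffAt ℝ ∞ (deriv (radialFactor f)) u := by
  have h1 : ContDiffAt ℝ ∞ (fderiv ℝ (radialFactor f)) u :=
    (hf.contDiffAt_radialFactor h h').fderiv_right (by simp)
  exact h1.clm_apply contDiffAt_const

theorem contDiffAt_hessForm {x : Sph m} {q : Tan x} (hq : ‖q‖ ∈ momRange f) (h0 : q ≠ 0)
    (ξ : Tan x) : ContDiffAt ℝ ∞ (fun q : Tan x => hessForm f q ξ) q := by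
  have hv := hf.contDiffAt_cos_invProfDeriv_norm hq h0
  have hm := hf.cos_invProfDeriv_mem hq (norm_ne_zero_iff.2 h0)
  have hM := (hf.contDiffAt_radialFactor hm.1 hm.2).comp q hv
  have hM' := (hf.contDiffAt_deriv_radialFactor hm.1 hm.2).comp q hv
  have hi : ContDiffAt ℝ ∞ (fun q : Tan x => ⟪q, ξ⟫) q := contDiffAt_id.inner ℝ contDiffAt_const
  exact ((hM.mul hv).neg.mul contDiffAt_const).add
    ((hM'.div (hM.pow 2) (pow_ne_zero 2 (hf.radialFactor_pos hm.1 hm.2).ne')).mul (hi.pow 2))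

/-- Along a line orthogonal to `ξ`, the Hessian form is continuous also at the zero momentum: there
the summand with `⟪q, ξ⟫` is identically zero. -/
theorem continuousAt_hessForm_line {x : Sph m} {q w ξ : Tan x} (hw : ⟪w, ξ⟫ = 0) {s : ℝ}
    (hs : ‖q + s • w‖ ∈ momRange f) : ContinuousAt (fun s : ℝ => hessForm f (q + s • w) ξ) s := by
  have hline : ContinuousAt (fun s : ℝ => q + s • w) s := by fun_prop
  by_cases h0 : q + s • w = 0
  · have hq : ⟪q, ξ⟫ = 0 := by
      have := congrArg (fun z : Tan x => ⟪z, ξ⟫) h0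
      simpa only [inner_add_left, real_inner_smul_left, hw, mul_zero, add_zero,
        inner_zero_left] using this
    have hi : ∀ s : ℝ, ⟪q + s • w, ξ⟫ = 0 := fun s => by
      rw [inner_add_left, real_inner_smul_left, hw, hq]; ring
    simp only [hessForm, hi]
    have hn : Tendsto (fun s : ℝ => ‖q + s • w‖) (𝓝 s) (𝓝[≥] 0) := by
      refine tendsto_nhdsWithin_iff.2 ⟨?_, Eventually.of_forall fun _ => norm_nonneg _⟩
      have := hline.norm.tendsto
      rwa [h0, norm_zero] at this
    have hv : ContinuousAt (fun s : ℝ => Real.cos (invProfDeriv f ‖q + s • w‖)) s := by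
      have h1 := (Real.continuous_cos.tendsto 0).comp (hf.tendsto_invProfDeriv_zero.comp hn)
      have h2 : Real.cos (invProfDeriv f ‖q + s • w‖) = Real.cos 0 := by
        rw [h0, norm_zero, hf.invProfDeriv_zero]
      rwa [← h2] at h1
    have hM : ContinuousAt (fun s : ℝ => radialFactor f (Real.cos (invProfDeriv f ‖q + s • w‖))) s :=
      ContinuousAt.comp (g := radialFactor f) (hf.continuousAt_radialFactor (by
        rw [h0, norm_zero, hf.invProfDeriv_zero, Real.cos_zero]; norm_num)) hv
    have h5 := (hM.mul hv).neg.mul (continuousAt_const (y := ‖ξ‖ ^ 2))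
    refine h5.congr (Eventually.of_forall fun s => ?_)
    change -(_ * _) * ‖ξ‖ ^ 2 = _
    ring
  · exact ContinuousAt.comp (g := fun q : Tan x => hessForm f q ξ)
      (hf.contDiffAt_hessForm hs h0 ξ).continuousAt hline

/-- What As is used for: on a segment of momenta at `x` that is orthogonal to `ξ`, the Hessian of
the cost in the direction `ξ` is a strictly convex function of the momentum. -/
theorem strictConvexOn_hessForm (hm : 1 ≤ m)
    (hAs : CondAs (radialCost f : Sph m → Sph m → EReal)) {x : Sph m} {q w ξ : Tan x} {D : Set ℝ}
    (hD : Convex ℝ D) (hDm : ∀ s ∈ D, ‖q + s • w‖ ∈ momRange f) (hξ : ξ ≠ 0) (hw : w ≠ 0)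
    (hwξ : ⟪w, ξ⟫ = 0) : StrictConvexOn ℝ D (fun s : ℝ => hessForm f (q + s • w) ξ) := by
  refine strictConvexOn_of_deriv2_pos hD
    (fun s hs => (hf.continuousAt_hessForm_line hwξ (hDm s hs)).continuousWithinAt) fun s hs => ?_
  obtain ⟨z, hz, hzs⟩ := hf.exists_of_norm_mem hm x (hDm s (interior_subset hs))
  obtain ⟨C, hC, H⟩ := hAs
  have h1 := H x z hz ξ w (by rw [real_inner_comm]; exact hwξ)
  rw [hf.costCurv_eq hm hz, hzs] at h1
  have h2 : (fun t : ℝ => hessForm f (q + s • w + t • w) ξ)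
      = fun t : ℝ => (fun s : ℝ => hessForm f (q + s • w) ξ) (s + t) := by
    funext t
    change _ = hessForm f (q + (s + t) • w) ξ
    rw [add_smul, add_assoc]
  rw [h2, congrFun (iteratedDeriv_comp_const_add 2 (fun s : ℝ => hessForm f (q + s • w) ξ) s) 0,
    iteratedDeriv_eq_iterate, add_zero] at h1
  refine lt_of_lt_of_le ?_ h1
  have := norm_pos_iff.2 hξ
  have := norm_pos_iff.2 hw
  positivity

/-- The derivative of the Hessian form in the momentum, at `q = -∇ₓ c(x,y)` and in a direction `w`
orthogonal to `ξ`. -/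
theorem hasDerivAt_hessForm_line {x y : Sph m} (h : y ≠ -x) (hxy : x ≠ y) {w ξ : Tan x}
    (hw : ⟪w, ξ⟫ = 0) {u : ℝ} (hu : ⟪(x : Amb m), (y : Amb m)⟫ = u) :
    HasDerivAt (fun s : ℝ => hessForm f (momentum f x y + s • w) ξ)
      (-(⟪(w : Amb m), (y : Amb m)⟫ / (u * radialFactor f u - (1 - u ^ 2) * deriv (radialFactor f) u))
        * (-(deriv (radialFactor f) u * u + radialFactor f u) * ‖ξ‖ ^ 2
          + (deriv (deriv (radialFactor f)) u
            - 2 * deriv (radialFactor f) u ^ 2 / radialFactor f u)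
              * ⟪(ξ : Amb m), (y : Amb m)⟫ ^ 2)) 0 := by
  have hu1 : -1 < u := hu ▸ neg_one_lt_inner_iff.2 h
  have hu2 : u < 1 := hu ▸ inner_sph_lt_one_iff.2 hxy
  have hr : sphDist x y ∈ Set.Ioo 0 Real.pi := arccos_mem_Ioo (hu ▸ hu1) (hu ▸ hu2)
  have hgr := hf.profDeriv_pos hr
  have hE : u * radialFactor f u - (1 - u ^ 2) * deriv (radialFactor f) u
      = profDeriv2 f (sphDist x y) := by
    rw [hf.one_sub_sq_mul_deriv_radialFactor hu1 hu2, ← hu, sphDist]; ring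
  have hE0 := hf.second_pos _ hr
  have hMpos := hf.radialFactor_pos hu1 hu2
  have hnq := hf.norm_momentum h
  have hq0 : momentum f x y ≠ 0 := by rw [← norm_ne_zero_iff, hnq]; exact hgr.ne'
  have hwy : ⟪momentum f x y, w⟫ = radialFactor f u * ⟪(w : Amb m), (y : Amb m)⟫ := by
    rw [momentum, real_inner_smul_left, inner_tanProj, hu]
  have hξy : ⟪momentum f x y, ξ⟫ = radialFactor f u * ⟪(ξ : Amb m), (y : Amb m)⟫ := by
    rw [momentum, real_inner_smul_left, inner_tanProj, hu]
  have hi : ∀ s : ℝ, ⟪momentum f x y + s • w, ξ⟫ = radialFactor f u * ⟪(ξ : Amb m), (y : Amb m)⟫ :=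
    fun s => by rw [inner_add_left, real_inner_smul_left, hw, hξy]; ring
  -- the derivative of the norm of the momentum
  have hn : HasDerivAt (fun s : ℝ => ‖momentum f x y + s • w‖)
      (radialFactor f u * ⟪(w : Amb m), (y : Amb m)⟫ / profDeriv f (sphDist x y)) 0 := by
    have h1 : HasDerivAt (fun s : ℝ => momentum f x y + s • w) w 0 := by
      simpa using ((hasDerivAt_id (0 : ℝ)).smul_const w).const_add (momentum f x y)
    have h2 := h1.norm_sq
    have h3 : HasDerivAt (fun s : ℝ => √(‖momentum f x y + s • w‖ ^ 2)) _ 0 :=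
      h2.sqrt (by simpa using hq0)
    simp only [Real.sqrt_sq (norm_nonneg _), zero_smul, add_zero] at h3
    refine h3.congr_deriv ?_
    rw [hnq, hwy]
    field_simp
  have hrho : HasDerivAt (fun s : ℝ => invProfDeriv f ‖momentum f x y + s • w‖)
      ((profDeriv2 f (sphDist x y))⁻¹ * (radialFactor f u * ⟪(w : Amb m), (y : Amb m)⟫
        / profDeriv f (sphDist x y))) 0 := by
    refine HasDerivAt.comp (h₂ := invProfDeriv f) 0 ?_ hn
    rw [zero_smul, add_zero, hnq]
    exact hf.hasDerivAt_invProfDeriv hr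
  have hv0 : Real.cos (invProfDeriv f ‖momentum f x y + (0 : ℝ) • w‖) = u := by
    rw [zero_smul, add_zero, hf.cos_invProfDeriv_norm_momentum h, hu]
  have hv : HasDerivAt (fun s : ℝ => Real.cos (invProfDeriv f ‖momentum f x y + s • w‖))
      (-(⟪(w : Amb m), (y : Amb m)⟫ / profDeriv2 f (sphDist x y))) 0 := by
    refine hrho.cos.congr_deriv ?_
    have hs : Real.sin (sphDist x y) * radialFactor f u = profDeriv f (sphDist x y) := by
      rw [sphDist, hu, Real.sin_arccos, mul_comm, hf.radialFactor_mul_sqrt hu1 hu2.le]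
    rw [zero_smul, add_zero, hf.invProfDeriv_norm_momentum h]
    field_simp
    linear_combination (-⟪(w : Amb m), (y : Amb m)⟫) * hs
  rw [hE]
  simp only [hessForm, hi]
  generalize profDeriv2 f (sphDist x y) = E at *
  generalize hVdef : (fun s : ℝ => Real.cos (invProfDeriv f ‖momentum f x y + s • w‖)) = V at hv
  have hVs : ∀ s, Real.cos (invProfDeriv f ‖momentum f x y + s • w‖) = V s :=
    fun s => by rw [← hVdef]
  simp only [hVs] at hv0 ⊢
  have hM : HasDerivAt (radialFactor f) (deriv (radialFactor f) u) (V 0) := by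
    rw [hv0]; exact ((hf.contDiffAt_radialFactor hu1 hu2).differentiableAt (by simp)).hasDerivAt
  have hM' : HasDerivAt (deriv (radialFactor f)) (deriv (deriv (radialFactor f)) u) (V 0) := by
    rw [hv0]; exact ((hf.contDiffAt_deriv_radialFactor hu1 hu2).differentiableAt
      (by simp)).hasDerivAt
  have h1 := hM.comp 0 hv
  have h2 := hM'.comp 0 hv
  have h3 := (((h1.mul hv).neg).mul_const (‖ξ‖ ^ 2)).add
    ((h2.div (h1.pow 2) (by rw [Pi.pow_apply, Function.comp, hv0]; exact (pow_pos hMpos 2).ne')).mul_const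
      ((radialFactor f u * ⟪(ξ : Amb m), (y : Amb m)⟫) ^ 2))
  refine h3.congr_deriv ?_
  simp only [Function.comp, hv0, Pi.pow_apply]
  field_simp
  ring

end IsConvexProfile

end Hessian

/-! ### The local maximum principle along c-segments -/

section LocalMaximum

variable {m : ℕ} {f : ℝ → ℝ}

section Curve

variable {Y : ℝ → Sph m} {v a : Amb m}

theorem eventually_ne_neg (hY : HasSecondDerivAt (fun t => (Y t : Amb m)) v a 0) {x : Sph m}
    (h : Y 0 ≠ -x) : ∀ᶠ t in 𝓝 0, Y t ≠ -x := by
  have h1 := (hY.inner_const (x : Amb m)).continuousAt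
  filter_upwards [h1.eventually (lt_mem_nhds (neg_one_lt_inner_iff.2 h))] with t ht
  exact neg_one_lt_inner_iff.1 ht

/-- The velocity of a curve on the sphere is tangent, and the normal part of its acceleration is
determined by the velocity. -/
theorem inner_velocity_eq_zero (hY : HasSecondDerivAt (fun t => (Y t : Amb m)) v a 0) :
    ⟪(Y 0 : Amb m), v⟫ = 0 ∧ ⟪(Y 0 : Amb m), a⟫ = -‖v‖ ^ 2 := by
  have h1 := hY.inner hY
  simp only [inner_self_sph] at h1
  obtain ⟨h2, h3⟩ := h1.unique (HasSecondDerivAt.const 1 0)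
  rw [real_inner_comm] at h2
  rw [real_inner_comm (Y 0 : Amb m) a, real_inner_self_eq_norm_sq] at h3
  constructor <;> linarith

/-- The velocity and the acceleration of a curve `Y` whose momentum with respect to `x` is affine,
paired with any vector `z`: these are the first two derivatives of `M(u) (Y - u x)`, `u = ⟪x,Y⟫`. -/
theorem IsConvexProfile.inner_derivs_of_affine_momentum (hf : IsConvexProfile f) {x : Sph m}
    {p ν : Tan x} (hY : HasSecondDerivAt (fun t => (Y t : Amb m)) v a 0)
    (hp : ∀ᶠ t in 𝓝 0, momentum f x (Y t) = p + t • ν) (h : Y 0 ≠ -x) (hxy : x ≠ Y 0)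
    {u M M₁ M₂ : ℝ} (hu : ⟪(x : Amb m), (Y 0 : Amb m)⟫ = u) (hM : radialFactor f u = M)
    (hM₁ : deriv (radialFactor f) u = M₁) (hM₂ : deriv (deriv (radialFactor f)) u = M₂)
    (z : Amb m) :
    M₁ * ⟪(x : Amb m), v⟫ * (⟪z, (Y 0 : Amb m)⟫ - u * ⟪z, (x : Amb m)⟫)
        + M * (⟪z, v⟫ - ⟪(x : Amb m), v⟫ * ⟪z, (x : Amb m)⟫) = ⟪z, (ν : Amb m)⟫ ∧
      (M₂ * ⟪(x : Amb m), v⟫ ^ 2 + M₁ * ⟪(x : Amb m), a⟫)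
          * (⟪z, (Y 0 : Amb m)⟫ - u * ⟪z, (x : Amb m)⟫)
        + 2 * (M₁ * ⟪(x : Amb m), v⟫) * (⟪z, v⟫ - ⟪(x : Amb m), v⟫ * ⟪z, (x : Amb m)⟫)
        + M * (⟪z, a⟫ - ⟪(x : Amb m), a⟫ * ⟪z, (x : Amb m)⟫) = 0 := by
  have hu1 : -1 < u := hu ▸ neg_one_lt_inner_iff.2 h
  have hu2 : u < 1 := hu ▸ inner_sph_lt_one_iff.2 hxy
  have hMj : HasSecondDerivAt (radialFactor f) M₁ M₂ ⟪(x : Amb m), (Y 0 : Amb m)⟫ := by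
    have := HasSecondDerivAt.of_contDiffAt
      (contDiffAt_infty.1 (hf.contDiffAt_radialFactor hu1 hu2) 2)
    rwa [hM₁, hM₂, ← hu] at this
  have huj := hY.inner_const (x : Amb m)
  have h1 := hMj.comp (h := fun t => ⟪(x : Amb m), (Y t : Amb m)⟫) huj
  have h2 := (hY.inner_const z).sub (huj.mul (HasSecondDerivAt.const ⟪z, (x : Amb m)⟫ 0))
  have h3 := h1.mul h2
  have haff : HasSecondDerivAt (fun t : ℝ => ⟪z, (p : Amb m)⟫ + t * ⟪z, (ν : Amb m)⟫)
      ⟪z, (ν : Amb m)⟫ 0 0 := by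
    refine ⟨fun _ => ⟪z, (ν : Amb m)⟫, Eventually.of_forall fun s => ?_, rfl, hasDerivAt_const _ _⟩
    simpa using ((hasDerivAt_id s).mul_const ⟪z, (ν : Amb m)⟫).const_add ⟪z, (p : Amb m)⟫
  obtain ⟨e1, e2⟩ := h3.unique (haff.congr (by
    filter_upwards [hp] with t ht
    have := congrArg (fun q : Tan x => ⟪z, (q : Amb m)⟫) ht
    simp only [coe_momentum, Submodule.coe_add, Submodule.coe_smul, inner_add_right,
      real_inner_smul_right, inner_sub_right] at this
    exact this))
  rw [hu, hM] at e1 e2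
  constructor
  · linear_combination e1
  · linear_combination e2

/-- The acceleration of a curve `Y` whose momentum with respect to `x` is affine, in the directions
`w` orthogonal to its velocity. -/
theorem IsConvexProfile.inner_acceleration (hf : IsConvexProfile f) {x : Sph m}
    {p ν : Tan x} (hY : HasSecondDerivAt (fun t => (Y t : Amb m)) v a 0)
    (hp : ∀ᶠ t in 𝓝 0, momentum f x (Y t) = p + t • ν) (h : Y 0 ≠ -x) (hxy : x ≠ Y 0)
    {u : ℝ} (hu : ⟪(x : Amb m), (Y 0 : Amb m)⟫ = u) (w : Tan (Y 0)) (hw : ⟪(w : Amb m), v⟫ = 0) :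
    ⟪(w : Amb m), a⟫ =
      ⟪(w : Amb m), (x : Amb m)⟫
          / (u * radialFactor f u - (1 - u ^ 2) * deriv (radialFactor f) u)
        * (-(deriv (radialFactor f) u * u + radialFactor f u) * ‖v‖ ^ 2
          + (deriv (deriv (radialFactor f)) u
            - 2 * deriv (radialFactor f) u ^ 2 / radialFactor f u) * ⟪v, (x : Amb m)⟫ ^ 2) := by
  have hu1 : -1 < u := hu ▸ neg_one_lt_inner_iff.2 h
  have hu2 : u < 1 := hu ▸ inner_sph_lt_one_iff.2 hxy
  have hr : sphDist x (Y 0) ∈ Set.Ioo 0 Real.pi := arccos_mem_Ioo (hu ▸ hu1) (hu ▸ hu2)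
  have hE : 0 < u * radialFactor f u - (1 - u ^ 2) * deriv (radialFactor f) u := by
    have := hf.second_pos _ hr
    rw [sphDist, hu] at this
    rw [hf.one_sub_sq_mul_deriv_radialFactor hu1 hu2]; linarith
  have hMpos := hf.radialFactor_pos hu1 hu2
  obtain ⟨hv, ha⟩ := inner_velocity_eq_zero hY
  have e1 := (hf.inner_derivs_of_affine_momentum hY hp h hxy hu rfl rfl rfl (w : Amb m)).2
  have e2 := (hf.inner_derivs_of_affine_momentum hY hp h hxy hu rfl rfl rfl (Y 0 : Amb m)).2
  rw [hw, real_inner_comm (Y 0 : Amb m) (w : Amb m), inner_tan] at e1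
  rw [inner_self_sph, hv, ha, real_inner_comm (x : Amb m) (Y 0 : Amb m), hu] at e2
  rw [real_inner_comm (x : Amb m) v]
  generalize radialFactor f u = M at *
  generalize deriv (deriv (radialFactor f)) u = M₂ at *
  generalize deriv (radialFactor f) u = M₁ at *
  generalize ⟪(x : Amb m), v⟫ = d at *
  generalize ⟪(x : Amb m), a⟫ = k at *
  generalize ⟪(w : Amb m), (x : Amb m)⟫ = ζ at *
  generalize ⟪(w : Amb m), a⟫ = A at *
  generalize ‖v‖ = V at *
  have hE' := hE.ne'
  rw [div_mul_eq_mul_div, eq_div_iff hE']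
  have hM' := hMpos.ne'
  field_simp
  linear_combination (u * M - (1 - u ^ 2) * M₁) * e1 - (M₁ * u + M) * ζ * e2

/-- First and second order conditions at a local maximum of `c(x₀,·) - c(x₁,·)` along a curve, in
terms of the momenta of `x₀` and `x₁` with respect to the point of the curve. -/
theorem IsConvexProfile.second_order_condition (hf : IsConvexProfile f) {x₀ x₁ y : Sph m}
    (hY : HasSecondDerivAt (fun t => (Y t : Amb m)) v a 0) (hY0 : Y 0 = y) (h₀ : y ≠ -x₀)
    (h₁ : y ≠ -x₁)
    (hmax : IsLocalMax (fun t => cosProfile f ⟪(x₀ : Amb m), (Y t : Amb m)⟫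
      - cosProfile f ⟪(x₁ : Amb m), (Y t : Amb m)⟫) 0) {ξ : Tan y} (hξ : (ξ : Amb m) = v) :
    ⟪momentum f y x₁ - momentum f y x₀, ξ⟫ = 0 ∧
      ⟪((momentum f y x₁ - momentum f y x₀ : Tan y) : Amb m), a⟫
        + hessForm f (momentum f y x₁) ξ - hessForm f (momentum f y x₀) ξ ≤ 0 := by
  subst hY0
  obtain ⟨hv, ha⟩ := inner_velocity_eq_zero hY
  have hj : ∀ x : Sph m, Y 0 ≠ -x →
      HasSecondDerivAt (fun t => cosProfile f ⟪(x : Amb m), (Y t : Amb m)⟫)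
        (-⟪momentum f (Y 0) x, ξ⟫)
        (-(⟪(momentum f (Y 0) x : Amb m), a⟫ + hessForm f (momentum f (Y 0) x) ξ)) 0 := by
    intro x hx
    have h1 := hf.hasSecondDerivAt_cosProfile (hY.inner_const (x : Amb m))
      (neg_one_lt_inner_iff.2 hx) (by
        by_cases hxy : x = Y 0
        · right; rw [hxy, hv]
        · left; exact inner_sph_lt_one_iff.2 hxy)
    convert h1 using 1
    · rw [momentum, real_inner_smul_left, inner_tanProj, hξ, real_inner_comm,
        real_inner_comm (x : Amb m) v]
    · rw [hf.hessForm_momentum (ne_neg_comm.1 hx), coe_momentum, real_inner_smul_left,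
        inner_sub_left, real_inner_smul_left, ha, hξ, real_inner_comm (x : Amb m) (Y 0 : Amb m),
        real_inner_comm (x : Amb m) v,
        show ‖ξ‖ = ‖v‖ by rw [← hξ]; rfl]
      ring
  obtain ⟨h2, h3⟩ := ((hj x₀ h₀).sub (hj x₁ h₁)).of_isLocalMax hmax
  rw [inner_sub_left, Submodule.coe_sub, inner_sub_left]
  constructor <;> linarith

end Curve

namespace IsConvexProfile

variable (hf : IsConvexProfile f)
include hf

/-- The c-segments are curves of class `C²` away from their base point. -/
theorem exists_curve {x y : Sph m} (h : y ≠ -x) (hxy : x ≠ y) (ν : Tan x) :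
    ∃ Y : ℝ → Sph m, Y 0 = y ∧ ContDiffAt ℝ 2 (fun t => (Y t : Amb m)) 0 ∧
      ∀ᶠ t in 𝓝 0, Y t ≠ -x ∧ momentum f x (Y t) = momentum f x y + t • ν := by
  set p := momentum f x y with hp
  have hp0 : p ≠ 0 := fun h0 => hxy (hf.eq_of_momentum_eq_zero h h0)
  have hline : Continuous fun t : ℝ => p + t • ν := by fun_prop
  have hl0 : Tendsto (fun t : ℝ => p + t • ν) (𝓝 0) (𝓝 p) := by
    simpa only [zero_smul, add_zero] using hline.tendsto 0
  have hmem : ∀ᶠ t : ℝ in 𝓝 0, p + t • ν ≠ 0 ∧ ‖p + t • ν‖ ∈ momRange f := by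
    filter_upwards [hl0.eventually_ne hp0,
      hl0.norm.eventually (hf.eventually_mem_momRange (hf.norm_momentum_mem h))] with t h1 h2
    exact ⟨h1, h2 (norm_nonneg _)⟩
  let V : ℝ → Tan x := fun t => (invProfDeriv f ‖p + t • ν‖ / ‖p + t • ν‖) • (p + t • ν)
  have hV : ∀ t : ℝ, p + t • ν ≠ 0 → ‖p + t • ν‖ ∈ momRange f →
      ‖V t‖ = invProfDeriv f ‖p + t • ν‖ ∧ invProfDeriv f ‖p + t • ν‖ ∈ Set.Ioo 0 Real.pi ∧
        profDeriv f (invProfDeriv f ‖p + t • ν‖) = ‖p + t • ν‖ := by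
    intro t h1 h2
    have hn := norm_pos_iff.2 h1
    obtain ⟨r, hr, hrp⟩ := hf.exists_pos_of_mem_momRange h2 hn.ne'
    have h3 : invProfDeriv f ‖p + t • ν‖ = r := by
      rw [← hrp, hf.invProfDeriv_profDeriv (Ioo_pi_sub_Ico hr)]
    refine ⟨?_, h3 ▸ hr, h3.symm ▸ hrp⟩
    rw [norm_smul, h3, Real.norm_of_nonneg (div_nonneg hr.1.le hn.le), div_mul_cancel₀ _ hn.ne']
  have hmom : ∀ t : ℝ, p + t • ν ≠ 0 → ‖p + t • ν‖ ∈ momRange f →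
      sphExp x (V t) ≠ -x ∧ momentum f x (sphExp x (V t)) = p + t • ν := by
    intro t h1 h2
    obtain ⟨h3, h4, h5⟩ := hV t h1 h2
    have hn := norm_ne_zero_iff.2 h1
    have hr := h4.1.ne'
    refine ⟨sphExp_ne_neg (by rw [h3]; exact h4.2), ?_⟩
    rw [momentum_sphExp (by rw [h3]; exact h4.2), h3, h5]
    simp only [V]
    rw [smul_smul, show ‖p + t • ν‖ / invProfDeriv f ‖p + t • ν‖
      * (invProfDeriv f ‖p + t • ν‖ / ‖p + t • ν‖) = 1 by field_simp, one_smul]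
  refine ⟨fun t => sphExp x (V t), ?_, ?_, hmem.mono fun t ht => hmom t ht.1 ht.2⟩
  · have h0 := hmem.self_of_nhds
    obtain ⟨h1, h2⟩ := hmom 0 h0.1 h0.2
    refine hf.momentum_injOn x h1 h ?_
    rw [h2, zero_smul, add_zero]
  · have hpl : ContDiffAt ℝ 2 (fun t : ℝ => p + t • ν) 0 := by fun_prop
    have h0' : p + (0 : ℝ) • ν ≠ 0 := hmem.self_of_nhds.1
    have hn : ContDiffAt ℝ 2 (fun t : ℝ => ‖p + t • ν‖) 0 := hpl.norm ℝ h0'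
    have hrho : ContDiffAt ℝ 2 (fun t : ℝ => invProfDeriv f ‖p + t • ν‖) 0 := by
      obtain ⟨r, hr, hrp⟩ := hf.exists_pos_of_mem_momRange hmem.self_of_nhds.2
        (norm_ne_zero_iff.2 h0')
      have h1 : ContDiffAt ℝ 2 _ _ := contDiffAt_infty.1 (hf.contDiffAt_invProfDeriv hr) 2
      rw [hrp] at h1
      exact h1.comp 0 hn
    have hmain : ContDiffAt ℝ 2 (fun t : ℝ => Real.cos (invProfDeriv f ‖p + t • ν‖) • (x : Amb m)
        + (Real.sin (invProfDeriv f ‖p + t • ν‖) / ‖p + t • ν‖) • ((p : Amb m) + t • (ν : Amb m)))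
        0 := by
      refine (hrho.cos.smul contDiffAt_const).add
        (((hrho.sin).div hn (norm_ne_zero_iff.2 h0')).smul (by fun_prop))
    refine hmain.congr_of_eventuallyEq ?_
    filter_upwards [hmem] with t ht
    obtain ⟨h3, h4, -⟩ := hV t ht.1 ht.2
    rw [coe_sphExp, expVec, h3]
    simp only [V]
    rw [Submodule.coe_smul, smul_smul, ← mul_div_assoc, sinc_mul_self]
    rfl

/-- Along a c-segment through its own base point `x`, which up to its parametrization is a geodesic,
the function `c(x,·) - c(x₁,·)` has no local maximum at `x`. -/
theorem not_localMax_at_base (hm : 1 ≤ m)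
    (hAs : CondAs (radialCost f : Sph m → Sph m → EReal)) {x x₁ : Sph m} (h01 : x ≠ x₁)
    (h₁ : x ≠ -x₁) {ν : Tan x} (hν : ν ≠ 0)
    (hmax : ∀ᶠ t : ℝ in 𝓝 0, ∀ z : Sph m, z ≠ -x → z ≠ -x₁ → momentum f x z = t • ν →
      cosProfile f ⟪(x : Amb m), (z : Amb m)⟫ - cosProfile f ⟪(x₁ : Amb m), (z : Amb m)⟫
        ≤ cosProfile f ⟪(x : Amb m), (x : Amb m)⟫ - cosProfile f ⟪(x₁ : Amb m), (x : Amb m)⟫) :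
    False := by
  have h₁' := ne_neg_comm.1 h₁
  have hw : momentum f x x₁ ≠ 0 := fun h => h01 (hf.eq_of_momentum_eq_zero h₁' h)
  obtain ⟨e, he, he1⟩ : ∃ e : Tan x, e = ‖ν‖⁻¹ • ν ∧ ‖e‖ = 1 := by
    refine ⟨_, rfl, ?_⟩
    rw [norm_smul, norm_inv, norm_norm, inv_mul_cancel₀ (norm_ne_zero_iff.2 hν)]
  have hnt : ∀ t : ℝ, ‖t • e‖ = |t| := fun t => by rw [norm_smul, he1, mul_one, Real.norm_eq_abs]
  have hY : HasSecondDerivAt (fun t : ℝ => (sphExp x (t • e) : Amb m)) (e : Amb m)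
      (-(x : Amb m)) 0 := by
    have hexp : ∀ t : ℝ, (sphExp x (t • e) : Amb m)
        = Real.cos t • (x : Amb m) + Real.sin t • (e : Amb m) := by
      intro t
      rw [coe_sphExp, expVec_smul, he1, one_mul, inv_one, one_smul]
    simp only [hexp]
    refine ⟨fun t => -Real.sin t • (x : Amb m) + Real.cos t • (e : Amb m),
      Eventually.of_forall fun t => ((Real.hasDerivAt_cos t).smul_const _).add
        ((Real.hasDerivAt_sin t).smul_const _), by simp, ?_⟩
    refine (((Real.hasDerivAt_sin 0).neg.smul_const (x : Amb m)).add
        ((Real.hasDerivAt_cos 0).smul_const (e : Amb m))).congr_deriv ?_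
    simp
  have hY0 : sphExp x ((0 : ℝ) • e) = x := by rw [zero_smul, sphExp_zero]
  have hσ : Tendsto (fun t : ℝ => profDeriv f |t| / |t| * t * ‖ν‖⁻¹) (𝓝 0) (𝓝 0) := by
    have hc : Tendsto (profDeriv f) (𝓝[Set.Ico 0 Real.pi] 0) (𝓝 0) := by
      have := hf.contDiffOn_profDeriv.continuousOn 0 zero_mem_Ico_pi
      rwa [ContinuousWithinAt, hf.zero] at this
    have habs : Tendsto (fun t : ℝ => |t|) (𝓝 0) (𝓝[Set.Ico 0 Real.pi] 0) := by
      refine tendsto_nhdsWithin_iff.2 ⟨?_, ?_⟩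
      · simpa using (continuous_abs (G := ℝ)).tendsto 0
      · filter_upwards [Ioo_mem_nhds (neg_lt_zero.2 Real.pi_pos) Real.pi_pos] with t ht
        exact ⟨abs_nonneg t, abs_lt.2 ht⟩
    have hb : Tendsto (fun t : ℝ => profDeriv f |t| * ‖ν‖⁻¹) (𝓝 0) (𝓝 0) := by
      simpa only [zero_mul, Function.comp_apply] using (hc.comp habs).mul_const ‖ν‖⁻¹
    refine squeeze_zero_norm (fun t => ?_) hb
    rw [norm_mul, norm_mul, norm_div, Real.norm_eq_abs |t|, abs_abs, Real.norm_eq_abs t,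
      Real.norm_of_nonneg (hf.profDeriv_nonneg _), Real.norm_of_nonneg (inv_nonneg.2
      (norm_nonneg ν))]
    refine mul_le_mul_of_nonneg_right ?_ (inv_nonneg.2 (norm_nonneg ν))
    by_cases h0 : |t| = 0
    · rw [h0, mul_zero]; exact hf.profDeriv_nonneg 0
    · rw [div_mul_cancel₀ _ h0]
  -- the geodesic with velocity `e` runs through the points whose momenta are multiples of `ν`
  have hloc : IsLocalMax (fun t : ℝ => cosProfile f ⟪(x : Amb m), (sphExp x (t • e) : Amb m)⟫
      - cosProfile f ⟪(x₁ : Amb m), (sphExp x (t • e) : Amb m)⟫) 0 := by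
    filter_upwards [hσ.eventually hmax, eventually_ne_neg hY (by rwa [hY0]),
      Ioo_mem_nhds (neg_lt_zero.2 Real.pi_pos) Real.pi_pos] with t ht ht₁ ht'
    have hlt : ‖t • e‖ < Real.pi := by rw [hnt]; exact abs_lt.2 ht'
    rw [hY0]
    refine ht _ (sphExp_ne_neg hlt) ht₁ ?_
    rw [momentum_sphExp hlt, hnt, he, smul_smul, smul_smul]
  obtain ⟨hc1, hc2⟩ := hf.second_order_condition hY hY0 (self_ne_neg x) h₁ hloc (ξ := e) rfl
  rw [momentum_self, sub_zero] at hc1 hc2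
  rw [inner_neg_right, real_inner_comm, inner_tan] at hc2
  have hG := hf.strictConvexOn_hessForm (q := 0) (w := momentum f x x₁) (ξ := e) hm hAs
    (convex_Icc (-1 : ℝ) 1) (fun s hs => by
      rw [zero_add, norm_smul]
      refine hf.mem_momRange_of_le (by positivity) ?_ (hf.norm_momentum_mem h₁')
      exact mul_le_of_le_one_left (norm_nonneg _) (abs_le.2 hs))
    (by rw [← norm_ne_zero_iff, he1]; exact one_ne_zero) hw hc1
  have hlt := hG.2 (x := -1) (y := 1) (by simp) (by simp) (by norm_num)
    (show (0 : ℝ) < 1 / 2 by norm_num) (show (0 : ℝ) < 1 / 2 by norm_num) (by norm_num)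
  -- the Hessian form is even, so its value at `0` lies below its value at the ends
  have heven : hessForm f (-momentum f x x₁) e = hessForm f (momentum f x x₁) e := by
    simp only [hessForm, norm_neg, inner_neg_left, neg_sq]
  simp only [smul_eq_mul, zero_add, neg_smul, one_smul, heven,
    show (1 / 2 * -1 + 1 / 2 * 1 : ℝ) = 0 by norm_num, zero_smul] at hlt
  linarith

/-- The local form of the maximum principle: along a c-segment with respect to `x₀`, the function
`c(x₀,·) - c(x₁,·)` has no interior local maximum. -/
theorem not_localMax_along_segment (hm : 1 ≤ m)
    (hAs : CondAs (radialCost f : Sph m → Sph m → EReal)) {x₀ x₁ y : Sph m} (h01 : x₀ ≠ x₁)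
    (h₀ : y ≠ -x₀) (h₁ : y ≠ -x₁) {ν : Tan x₀} (hν : ν ≠ 0)
    (hmax : ∀ᶠ t : ℝ in 𝓝 0, ∀ z : Sph m, z ≠ -x₀ → z ≠ -x₁ →
      momentum f x₀ z = momentum f x₀ y + t • ν →
      cosProfile f ⟪(x₀ : Amb m), (z : Amb m)⟫ - cosProfile f ⟪(x₁ : Amb m), (z : Amb m)⟫
        ≤ cosProfile f ⟪(x₀ : Amb m), (y : Amb m)⟫ - cosProfile f ⟪(x₁ : Amb m), (y : Amb m)⟫) :
    False := by
  have h₀' := ne_neg_comm.1 h₀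
  have h₁' := ne_neg_comm.1 h₁
  have hw : momentum f y x₁ - momentum f y x₀ ≠ 0 := fun h =>
    h01 (hf.momentum_injOn y h₀' h₁' (sub_eq_zero.1 h).symm)
  by_cases hxy : x₀ = y
  · subst hxy
    refine hf.not_localMax_at_base hm hAs h01 h₁ hν ?_
    simpa only [momentum_self, zero_add] using hmax
  · obtain ⟨Y, hY0, hYs, hYm⟩ := hf.exists_curve h₀ hxy ν
    have hY := HasSecondDerivAt.of_contDiffAt hYs
    generalize deriv (fun t => (Y t : Amb m)) 0 = v at hY
    generalize deriv (deriv (fun t => (Y t : Amb m))) 0 = a at hY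
    subst hY0
    have hloc : IsLocalMax (fun t => cosProfile f ⟪(x₀ : Amb m), (Y t : Amb m)⟫
      - cosProfile f ⟪(x₁ : Amb m), (Y t : Amb m)⟫) 0 := by
      filter_upwards [hYm, hmax, eventually_ne_neg hY h₁] with t ht ht' ht₁
      exact ht' _ ht.1 ht₁ ht.2
    have hp := hYm.mono fun t ht => ht.2
    have hv := (inner_velocity_eq_zero hY).1
    let ξ : Tan (Y 0) := ⟨v, Submodule.mem_orthogonal_singleton_iff_inner_right.2 hv⟩
    obtain ⟨hc1, hc2⟩ := hf.second_order_condition hY rfl h₀ h₁ hloc (ξ := ξ) rfl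
    have hξ0 : ξ ≠ 0 := by
      intro h0
      have hv0 : v = 0 := congrArg Subtype.val h0
      have h3 := (hf.inner_derivs_of_affine_momentum hY hp h₀ hxy rfl rfl rfl rfl (ν : Amb m)).1
      rw [hv0] at h3
      simp only [inner_zero_right, mul_zero, zero_mul, sub_zero, add_zero] at h3
      exact hν (Subtype.ext (inner_self_eq_zero.1 h3.symm))
    have hmem : ∀ s ∈ Set.Icc (0 : ℝ) 1, ‖momentum f (Y 0) x₀
        + s • (momentum f (Y 0) x₁ - momentum f (Y 0) x₀)‖ ∈ momRange f := by
      intro s hs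
      refine hf.norm_mem_momRange_of_mem_segment (hf.norm_momentum_mem h₀')
        (hf.norm_momentum_mem h₁') ?_
      rw [segment_eq_image']
      exact ⟨s, hs, rfl⟩
    have hG := hf.strictConvexOn_hessForm hm hAs (convex_Icc (0 : ℝ) 1) hmem hξ0 hw hc1
    have hder := hf.hasDerivAt_hessForm_line h₀' (Ne.symm hxy) hc1 rfl
    have hslope := hG.lt_slope_of_hasDerivAt (by simp) (by simp) zero_lt_one hder
    have hacc := hf.inner_acceleration hY hp h₀ hxy (real_inner_comm _ _) _
      (show ⟪((momentum f (Y 0) x₁ - momentum f (Y 0) x₀ : Tan (Y 0)) : Amb m), v⟫ = 0 from hc1)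
    -- the second-order condition bounds the increment of the Hessian form between the momenta of
    -- `x₀` and `x₁` by its derivative at the first of them, against strict convexity
    rw [slope_def_field] at hslope
    simp only [one_smul, zero_smul, add_zero, sub_zero, div_one, add_sub_cancel] at hslope
    rw [hacc] at hc2
    have hξv : ‖ξ‖ = ‖v‖ := rfl
    rw [hξv] at hslope
    change _ * (_ + _ * ⟪v, (x₀ : Amb m)⟫ ^ 2) < _ at hslope
    linarith

end IsConvexProfile

end LocalMaximum

/-! ### The cost with values in the extended reals and the global maximum principle -/

section ExtendedCost

variable {m : ℕ} {f : ℝ → ℝ}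

theorem extendPi_of_lt {t : ℝ} (ht : t < Real.pi) : extendPi f t = (f t : EReal) := if_pos ht

theorem sphDist_mem_Icc (x y : Sph m) : sphDist x y ∈ Set.Icc 0 Real.pi :=
  ⟨Real.arccos_nonneg _, Real.arccos_le_pi _⟩

theorem continuous_sphDist : Continuous fun z : Sph m × Sph m => sphDist z.1 z.2 :=
  Real.continuous_arccos.comp
    ((continuous_subtype_val.comp continuous_fst).inner (continuous_subtype_val.comp continuous_snd))

theorem radialCost_neg_self (y : Sph m) : radialCost f (-y) y = extendPi f Real.pi := by
  rw [radialCost, sphDist_comm, sphDist_neg]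

namespace IsProfile

variable (hf : IsProfile f)
include hf

theorem monotoneOn_extendPi : MonotoneOn (extendPi f) (Set.Icc 0 Real.pi) := by
  intro s hs t ht hst
  rcases ht.2.lt_or_eq with h | rfl
  · rw [extendPi_of_lt h, extendPi_of_lt (hst.trans_lt h)]
    exact EReal.coe_le_coe_iff.2
      (hf.mono.monotoneOn ⟨hs.1, hst.trans_lt h⟩ ⟨ht.1, h⟩ hst)
  · rcases hst.lt_or_eq with h | rfl
    · rw [extendPi_of_lt h, extendPi, if_neg (lt_irrefl _)]
      exact le_iSup₂ (f := fun s (_ : s ∈ Set.Ico 0 Real.pi) => (f s : EReal)) s ⟨hs.1, h⟩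
    · rfl

theorem extendPi_ne_bot {t : ℝ} (ht : t ∈ Set.Icc 0 Real.pi) : extendPi f t ≠ ⊥ := by
  have h := hf.monotoneOn_extendPi ⟨le_rfl, Real.pi_pos.le⟩ ht ht.1
  rw [extendPi_of_lt Real.pi_pos] at h
  exact (lt_of_lt_of_le (EReal.bot_lt_coe _) h).ne'

theorem radialCost_ne_bot (x y : Sph m) : radialCost f x y ≠ ⊥ :=
  hf.extendPi_ne_bot (sphDist_mem_Icc x y)

theorem continuousOn_extendPi : ContinuousOn (extendPi f) (Set.Icc 0 Real.pi) := by
  intro t ht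
  rcases ht.2.lt_or_eq with h | rfl
  · have h1 : ContinuousWithinAt (fun s => (f s : EReal)) (Set.Icc 0 Real.pi) t := by
      refine continuous_coe_real_ereal.continuousAt.comp_continuousWithinAt ?_
      refine (hf.smooth.continuousOn t ⟨ht.1, h⟩).mono_of_mem_nhdsWithin ?_
      filter_upwards [self_mem_nhdsWithin, mem_nhdsWithin_of_mem_nhds (Iio_mem_nhds h)] with s h1 h2
      exact ⟨h1.1, h2⟩
    refine h1.congr_of_eventuallyEq_of_mem ?_ ht
    filter_upwards [mem_nhdsWithin_of_mem_nhds (Iio_mem_nhds h)] with s hs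
    exact extendPi_of_lt hs
  · refine tendsto_order.2 ⟨fun b hb => ?_, fun b hb => ?_⟩
    · rw [extendPi, if_neg (lt_irrefl _)] at hb
      obtain ⟨s, hs⟩ := lt_iSup_iff.1 hb
      obtain ⟨hs', hs⟩ := lt_iSup_iff.1 hs
      filter_upwards [self_mem_nhdsWithin,
        mem_nhdsWithin_of_mem_nhds (Ioi_mem_nhds hs'.2)] with t ht hst
      refine hs.trans_le ?_
      rw [← extendPi_of_lt (f := f) hs'.2]
      exact hf.monotoneOn_extendPi ⟨hs'.1, hs'.2.le⟩ ht (le_of_lt hst)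
    · filter_upwards [self_mem_nhdsWithin] with t ht'
      exact (hf.monotoneOn_extendPi ht' ht ht'.2).trans_lt hb

theorem continuous_radialCost : Continuous fun z : Sph m × Sph m => radialCost f z.1 z.2 :=
  hf.continuousOn_extendPi.comp_continuous continuous_sphDist fun z => sphDist_mem_Icc z.1 z.2

theorem continuous_radialCost_right (x : Sph m) :
    Continuous fun z : Sph m => radialCost f x z :=
  Continuous.comp (f := fun z : Sph m => (x, z)) hf.continuous_radialCost
    (continuous_const.prodMk continuous_id)

theorem continuousAt_radialCost_sub {x₀ z : Sph m} (hz : z ≠ -x₀) (x₁ : Sph m) :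
    ContinuousAt (fun z : Sph m => radialCost f x₀ z - radialCost f x₁ z) z := by
  have h3 : ContinuousAt (fun p : EReal × EReal => p.1 + p.2)
      (radialCost f x₀ z, -radialCost f x₁ z) := by
    refine EReal.continuousAt_add (Or.inl ?_) (Or.inl ?_) <;> rw [radialCost_eq hz]
    · exact EReal.coe_ne_top _
    · exact EReal.coe_ne_bot _
  exact ContinuousAt.comp (f := fun z : Sph m => (radialCost f x₀ z, -radialCost f x₁ z)) h3
    ((hf.continuous_radialCost_right x₀).prodMk (hf.continuous_radialCost_right x₁).neg).continuousAt

theorem continuousOn_momentum (x : Sph m) : ContinuousOn (momentum f x) {y | y ≠ -x} := by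
  intro y hy
  have hi : Continuous fun y : Sph m => ⟪(x : Amb m), (y : Amb m)⟫ :=
    continuous_const.inner continuous_subtype_val
  have h1 : ContinuousAt (fun y : Sph m => radialFactor f ⟪(x : Amb m), (y : Amb m)⟫) y :=
    ContinuousAt.comp (g := radialFactor f)
      (hf.continuousAt_radialFactor (neg_one_lt_inner_iff.2 hy)) hi.continuousAt
  have h2 : Continuous fun y : Sph m => tanProj x (y : Amb m) :=
    (continuous_subtype_val.sub (hi.smul continuous_const)).subtype_mk _
  exact (h1.smul h2.continuousAt).continuousWithinAt

end IsProfile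

namespace IsConvexProfile

variable (hf : IsConvexProfile f)
include hf

/-- If `f` is bounded, its extension to `[0, π]` is convex. -/
theorem convexOn_extendPi (hP : extendPi f Real.pi ≠ ⊤) :
    ConvexOn ℝ (Set.Icc 0 Real.pi) fun t => (extendPi f t).toReal := by
  have hfin : ∀ t ∈ Set.Icc 0 Real.pi, extendPi f t ∈ ({⊥, ⊤}ᶜ : Set EReal) := by
    intro t ht
    have h1 := hf.extendPi_ne_bot ht
    have h2 : extendPi f t ≠ ⊤ := fun h => hP (top_le_iff.1
      (h ▸ hf.monotoneOn_extendPi ht ⟨Real.pi_pos.le, le_rfl⟩ ht.2))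
    simp [h1, h2]
  have heq : ∀ t ∈ Set.Ioo 0 Real.pi, HasDerivAt (fun t => (extendPi f t).toReal)
      (profDeriv f t) t := by
    intro t ht
    refine (hf.hasDerivAt ht).congr_of_eventuallyEq ?_
    filter_upwards [Iio_mem_nhds ht.2] with s hs
    rw [extendPi_of_lt hs, EReal.toReal_coe]
  refine MonotoneOn.convexOn_of_deriv (convex_Icc _ _)
    (EReal.continuousOn_toReal.comp hf.continuousOn_extendPi hfin) ?_ ?_
  · rw [interior_Icc]
    exact fun t ht => (heq t ht).differentiableAt.differentiableWithinAt
  · rw [interior_Icc]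
    intro s hs t ht hst
    rw [(heq s hs).deriv, (heq t ht).deriv]
    exact hf.strictMono.monotoneOn (Ioo_pi_sub_Ico hs) (Ioo_pi_sub_Ico ht) hst

/-- Moving mass between `y` and its antipode: a consequence of the convexity of `f` and of the
triangle inequality. -/
theorem radialCost_add_le (x y z : Sph m) :
    radialCost f x y + radialCost f (-y) z ≤ radialCost f (-y) y + radialCost f x z := by
  by_cases hP : extendPi f Real.pi = ⊤
  · rw [radialCost_neg_self, hP, EReal.top_add_of_ne_bot (hf.radialCost_ne_bot x z)]
    exact le_top
  have hcoe : ∀ t ∈ Set.Icc 0 Real.pi, extendPi f t = ((extendPi f t).toReal : EReal) := by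
    intro t ht
    refine (EReal.coe_toReal (fun h => hP (top_le_iff.1 ?_)) (hf.extendPi_ne_bot ht)).symm
    exact h ▸ hf.monotoneOn_extendPi ht ⟨Real.pi_pos.le, le_rfl⟩ ht.2
  have hconv := hf.convexOn_extendPi hP
  have hmono : ∀ s ∈ Set.Icc 0 Real.pi, ∀ t ∈ Set.Icc 0 Real.pi, s ≤ t →
      (extendPi f s).toReal ≤ (extendPi f t).toReal := by
    intro s hs t ht hst
    have := hf.monotoneOn_extendPi hs ht hst
    rw [hcoe s hs, hcoe t ht] at this
    exact EReal.coe_le_coe_iff.1 this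
  have hpi : Real.pi ∈ Set.Icc 0 Real.pi := ⟨Real.pi_pos.le, le_rfl⟩
  rw [radialCost_neg_self, radialCost, radialCost, radialCost, hcoe _ (sphDist_mem_Icc x y),
    hcoe _ (sphDist_mem_Icc (-y) z), hcoe _ (sphDist_mem_Icc x z), hcoe _ hpi, ← EReal.coe_add,
    ← EReal.coe_add, EReal.coe_le_coe_iff]
  have ha := sphDist_mem_Icc x y
  have hb := sphDist_mem_Icc x z
  have he := sphDist_mem_Icc (-y) z
  have htri := sphDist_triangle x z y
  rw [sphDist_comm z y] at htri
  have hed := sphDist_neg_left y z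
  generalize sphDist x y = α at *
  generalize sphDist x z = β at *
  generalize sphDist (-y) z = ε at *
  rcases le_or_gt α β with h | h
  · linarith [hmono _ ha _ hb h, hmono _ he _ hpi he.2]
  · have hβ : 0 < Real.pi - β := by linarith [ha.2]
    have h1 : ε ≤ Real.pi - α + β := by linarith
    have h2 : Real.pi - α + β ∈ Set.Icc 0 Real.pi := ⟨he.1.trans h1, by linarith⟩
    -- `α` and `π - α + β` are complementary convex combinations of `β` and `π`
    have hl : 0 ≤ (Real.pi - α) / (Real.pi - β) := div_nonneg (by linarith [ha.2]) hβ.le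
    have hl' : 0 ≤ (α - β) / (Real.pi - β) := div_nonneg (by linarith) hβ.le
    have hsum : (Real.pi - α) / (Real.pi - β) + (α - β) / (Real.pi - β) = 1 := by
      field_simp; ring
    have c1 := hconv.2 hb hpi hl hl' hsum
    have c2 := hconv.2 hb hpi hl' hl (by rw [add_comm]; exact hsum)
    simp only [smul_eq_mul] at c1 c2
    rw [show (Real.pi - α) / (Real.pi - β) * β + (α - β) / (Real.pi - β) * Real.pi = α by
      field_simp; ring] at c1
    rw [show (α - β) / (Real.pi - β) * β + (Real.pi - α) / (Real.pi - β) * Real.pi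
      = Real.pi - α + β by field_simp; ring] at c2
    have c3 := hmono _ he _ h2 h1
    linear_combination c1 + c2 + c3 + ((extendPi f β).toReal + (extendPi f Real.pi).toReal) * hsum

/-- The c-segments are compact: they stay away from the antipode of their base point. -/
theorem isCompact_momentum_segment {x y₀ y₁ : Sph m} (h₀ : y₀ ≠ -x) (h₁ : y₁ ≠ -x) :
    IsCompact {y : Sph m | y ≠ -x ∧
      momentum f x y ∈ segment ℝ (momentum f x y₀) (momentum f x y₁)} := by
  set D := max (sphDist x y₀) (sphDist x y₁) with hD
  have hDpi : D ∈ Set.Ico 0 Real.pi := by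
    rcases max_choice (sphDist x y₀) (sphDist x y₁) with h | h <;> rw [hD, h]
    · exact sphDist_mem_Ico h₀
    · exact sphDist_mem_Ico h₁
  have hfar : ∀ z : Sph m, sphDist x z ≤ D → z ≠ -x := by
    rintro z hz rfl
    rw [sphDist_neg] at hz
    exact absurd hDpi.2 (not_lt.2 hz)
  have heq : {y : Sph m | y ≠ -x ∧
      momentum f x y ∈ segment ℝ (momentum f x y₀) (momentum f x y₁)} = {y | sphDist x y ≤ D} ∩
        momentum f x ⁻¹' segment ℝ (momentum f x y₀) (momentum f x y₁) := by
    ext z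
    refine ⟨fun hz => ⟨?_, hz.2⟩, fun hz => ⟨hfar z hz.1, hz.2⟩⟩
    have h2 : ‖momentum f x z‖ ≤ max ‖momentum f x y₀‖ ‖momentum f x y₁‖ :=
      (convexOn_univ_norm (E := Tan x)).le_on_segment (Set.mem_univ _) (Set.mem_univ _) hz.2
    rw [hf.norm_momentum hz.1, hf.norm_momentum h₀, hf.norm_momentum h₁] at h2
    refine (hf.strictMono.le_iff_le (sphDist_mem_Ico hz.1) hDpi).1 (h2.trans (max_le ?_ ?_))
    · exact hf.strictMono.monotoneOn (sphDist_mem_Ico h₀) hDpi (le_max_left _ _)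
    · exact hf.strictMono.monotoneOn (sphDist_mem_Ico h₁) hDpi (le_max_right _ _)
  have hdist : Continuous fun z : Sph m => sphDist x z :=
    Continuous.comp (f := fun z : Sph m => (x, z)) continuous_sphDist
      (continuous_const.prodMk continuous_id)
  rw [heq]
  refine IsClosed.isCompact ?_
  refine ((hf.continuousOn_momentum x).mono fun z hz => hfar z hz).preimage_isClosed_of_isClosed
    (isClosed_le hdist continuous_const) ?_
  rw [segment_eq_image]
  exact (isCompact_Icc.image (by fun_prop)).isClosed

/-- The function `c(x₀,·) - c(x₁,·)` is smallest at the antipode of `x₁`. -/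
theorem radialCost_sub_antipode_le {x₀ x₁ y : Sph m} (h : -x₁ ≠ -x₀) (hy : y ≠ -x₀) :
    radialCost f x₀ (-x₁) - radialCost f x₁ (-x₁) ≤ radialCost f x₀ y - radialCost f x₁ y := by
  have h4 := hf.radialCost_add_le x₀ (-x₁) y
  rw [neg_neg] at h4
  have hb := hf.radialCost_ne_bot x₁ y
  rw [radialCost_eq h, radialCost_eq hy] at h4 ⊢
  generalize radialCost f x₁ (-x₁) = P at *
  generalize radialCost f x₁ y = B at *
  induction P with
  | bot =>
    exfalso
    induction B with
    | bot => exact hb rfl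
    | coe b => simp [← EReal.coe_add] at h4
    | top => simp at h4
  | top => simp
  | coe P =>
    induction B with
    | bot => exact absurd rfl hb
    | coe b =>
      norm_cast at h4 ⊢
      linarith
    | top =>
      exfalso
      rw [EReal.coe_add_top, ← EReal.coe_add] at h4
      exact EReal.coe_ne_top _ (top_le_iff.1 h4)

/-- Loeper's maximum principle: along a c-segment with respect to `x₀`, the function
`c(x₀,·) - c(x₁,·)` is bounded by its values at the ends. -/
theorem cost_sub_le_max (hm : 1 ≤ m)
    (hAs : CondAs (radialCost f : Sph m → Sph m → EReal)) {x₀ y₀ y₁ y : Sph m}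
    (h₀ : y₀ ≠ -x₀) (h₁ : y₁ ≠ -x₀) (hy : y ≠ -x₀)
    (hseg : momentum f x₀ y ∈ segment ℝ (momentum f x₀ y₀) (momentum f x₀ y₁)) (x₁ : Sph m) :
    radialCost f x₀ y - radialCost f x₁ y ≤
      max (radialCost f x₀ y₀ - radialCost f x₁ y₀) (radialCost f x₀ y₁ - radialCost f x₁ y₁) := by
  by_cases h01 : x₀ = x₁
  · subst h01
    have : ∀ z : Sph m, z ≠ -x₀ → radialCost f x₀ z - radialCost f x₀ z = 0 := fun z hz => by
      rw [radialCost_eq hz, ← EReal.coe_sub, sub_self]; rfl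
    rw [this y hy, this _ h₀, this _ h₁, max_self]
  obtain ⟨z, ⟨hz, hzT⟩, hzmax⟩ := (hf.isCompact_momentum_segment h₀ h₁).exists_isMaxOn
    ⟨y, hy, hseg⟩ fun z hz =>
      (hf.continuousAt_radialCost_sub hz.1 x₁).continuousWithinAt
  refine (hzmax ⟨hy, hseg⟩).trans ?_
  by_cases hzx : z = -x₁
  · subst hzx
    exact le_max_of_le_left (hf.radialCost_sub_antipode_le hz h₀)
  obtain ⟨t, ht, htz⟩ : ∃ t ∈ Set.Icc (0 : ℝ) 1,
      momentum f x₀ y₀ + t • (momentum f x₀ y₁ - momentum f x₀ y₀) = momentum f x₀ z := by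
    rw [segment_eq_image'] at hzT
    exact hzT
  rcases ht.1.eq_or_lt with h0 | h0
  · rw [← h0, zero_smul, add_zero] at htz
    rw [hf.momentum_injOn x₀ hz h₀ htz.symm]; exact le_max_left _ _
  rcases ht.2.eq_or_lt with h1 | h1
  · rw [h1, one_smul, add_sub_cancel] at htz
    rw [hf.momentum_injOn x₀ hz h₁ htz.symm]; exact le_max_right _ _
  by_cases hν : momentum f x₀ y₁ - momentum f x₀ y₀ = 0
  · rw [hν, smul_zero, add_zero] at htz
    rw [hf.momentum_injOn x₀ hz h₀ htz.symm]; exact le_max_left _ _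
  refine (hf.not_localMax_along_segment hm hAs h01 hz hzx hν ?_).elim
  have hnear : ∀ᶠ s : ℝ in 𝓝 0, t + s ∈ Set.Icc (0 : ℝ) 1 := by
    have : Tendsto (fun s : ℝ => t + s) (𝓝 0) (𝓝 t) := by
      have hc : Continuous fun s : ℝ => t + s := by fun_prop
      simpa only [add_zero] using hc.tendsto 0
    exact this.eventually (Icc_mem_nhds h0 h1)
  filter_upwards [hnear] with s hs w hw hwx hws
  have hwT : momentum f x₀ w ∈ segment ℝ (momentum f x₀ y₀) (momentum f x₀ y₁) := by
    rw [segment_eq_image']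
    refine ⟨t + s, hs, ?_⟩
    change momentum f x₀ y₀ + (t + s) • (momentum f x₀ y₁ - momentum f x₀ y₀) = _
    rw [hws, ← htz, add_smul, add_assoc]
  have h5 : radialCost f x₀ w - radialCost f x₁ w ≤ radialCost f x₀ z - radialCost f x₁ z :=
    hzmax ⟨hw, hwT⟩
  rwa [radialCost_eq hw, radialCost_eq hwx, radialCost_eq hz, radialCost_eq hzx,
    ← EReal.coe_sub, ← EReal.coe_sub, EReal.coe_le_coe_iff] at h5

end IsConvexProfile

end ExtendedCost

/-! ### Contact sets and subdifferentials -/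

section Contact

variable {m : ℕ} {f : ℝ → ℝ}

theorem hasDerivAt_expVec_line (x : Sph m) (ξ : Tan x) :
    HasDerivAt (fun t : ℝ => expVec x (t • ξ)) (ξ : Amb m) 0 := by
  simp only [expVec_smul]
  have h3 : HasDerivAt (fun s : ℝ => ‖ξ‖ * s) ‖ξ‖ 0 := by
    simpa using (hasDerivAt_id (0 : ℝ)).const_mul ‖ξ‖
  refine ((h3.cos.smul_const (x : Amb m)).add
    (h3.sin.smul_const (‖ξ‖⁻¹ • (ξ : Amb m)))).congr_deriv ?_
  simp only [mul_zero, Real.sin_zero, Real.cos_zero, neg_zero, zero_mul, zero_smul, one_mul,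
    zero_add, smul_smul]
  by_cases h : ξ = 0
  · simp [h]
  · rw [mul_inv_cancel₀ (norm_ne_zero_iff.2 h), one_smul]

theorem tendsto_coe_add {a : ℕ → ℝ} {A : ℕ → EReal} {b : ℝ} {B : EReal}
    (ha : Tendsto a atTop (𝓝 b)) (hA : Tendsto A atTop (𝓝 B)) :
    Tendsto (fun n => (a n : EReal) + A n) atTop (𝓝 ((b : EReal) + B)) := by
  have h : ContinuousAt (fun p : EReal × EReal => p.1 + p.2) ((b : EReal), B) :=
    EReal.continuousAt_add (Or.inl (EReal.coe_ne_top _)) (Or.inl (EReal.coe_ne_bot _))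
  have h1 : Tendsto (fun n => ((a n : EReal), A n)) atTop (𝓝 ((b : EReal), B)) :=
    (EReal.tendsto_coe.2 ha).prodMk_nhds hA
  exact Tendsto.comp (g := fun p : EReal × EReal => p.1 + p.2) h h1

theorem eventually_ne_neg_of_tendsto {X Y : ℕ → Sph m} {x y : Sph m} (h : y ≠ -x)
    (hX : Tendsto X atTop (𝓝 x)) (hY : Tendsto Y atTop (𝓝 y)) : ∀ᶠ n in atTop, Y n ≠ -X n := by
  have h1 := ((continuous_subtype_val.tendsto x).comp hX).inner
    (𝕜 := ℝ) ((continuous_subtype_val.tendsto y).comp hY)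
  filter_upwards [h1.eventually (lt_mem_nhds (neg_one_lt_inner_iff.2 h))] with n hn
  exact neg_one_lt_inner_iff.1 hn

theorem radialCost_self (y : Sph m) : radialCost f y y = (f 0 : EReal) := by
  rw [radialCost, sphDist_self, extendPi_of_lt Real.pi_pos]

namespace IsProfile

variable (hf : IsProfile f)
include hf

theorem tendsto_radialCost {X Y : ℕ → Sph m} {x y : Sph m}
    (h : Tendsto (fun n => (X n, Y n)) atTop (𝓝 (x, y))) :
    Tendsto (fun n => radialCost f (X n) (Y n)) atTop (𝓝 (radialCost f x y)) := by
  have h2 : Tendsto (fun z : Sph m × Sph m => radialCost f z.1 z.2) (𝓝 (x, y))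
      (𝓝 (radialCost f x y)) := hf.continuous_radialCost.tendsto (x, y)
  have h3 := h2.comp h
  exact h3

theorem radialCost_le_antipodal (x y z : Sph m) : radialCost f x y ≤ radialCost f z (-z) := by
  rw [radialCost_comm z, radialCost_neg_self]
  exact hf.monotoneOn_extendPi (sphDist_mem_Icc x y) ⟨Real.pi_pos.le, le_rfl⟩
    (sphDist_mem_Icc x y).2

/-- If the cost is finite at an antipodal pair, it is finite. -/
theorem exists_radialCost_eq_coe {z : Sph m} {k : ℝ} (h : radialCost f z (-z) = k) (x y : Sph m) :
    ∃ l : ℝ, radialCost f x y = l := by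
  have h1 := hf.radialCost_le_antipodal x y z
  rw [h] at h1
  exact ⟨_, (EReal.coe_toReal (h1.trans_lt (EReal.coe_lt_top k)).ne (hf.radialCost_ne_bot x y)).symm⟩

/-- The contact set consists of the `y` such that `x` minimizes `φ + c(·,y)`. -/
theorem mem_contactSet_iff {φ : Sph m → ℝ} {x y : Sph m} :
    y ∈ contactSet (radialCost f) φ x ↔
      ∀ x', (φ x : EReal) + radialCost f x y ≤ (φ x' : EReal) + radialCost f x' y := by
  have hself := radialCost_self (f := f) y
  rw [contactSet, Set.mem_ofPred_eq]
  constructor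
  · intro h x'
    have hle : ∀ x', -(radialCost f y x') - (φ x' : EReal) ≤ cTransform (radialCost f) φ y :=
      fun x' => le_iSup (fun z => -(radialCost f y z) - (φ z : EReal)) x'
    have hbot := hf.radialCost_ne_bot x y
    have hbot' := hf.radialCost_ne_bot x' y
    have h0 := hle y
    have h1 := hle x'
    rw [hself, ← EReal.coe_neg, ← EReal.coe_sub] at h0
    rw [radialCost_comm y x'] at h1
    generalize radialCost f x y = A at *
    generalize radialCost f x' y = B at *
    generalize cTransform (radialCost f) φ y = C at *
    induction C with
    | bot => exact absurd (le_bot_iff.1 h0) (EReal.coe_ne_bot _)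
    | top =>
      rw [EReal.coe_add_top, eq_comm, EReal.neg_eq_top_iff] at h
      exact absurd h hbot
    | coe C =>
      induction A with
      | bot => exact absurd rfl hbot
      | top =>
        rw [← EReal.coe_add, EReal.neg_top] at h
        exact absurd h (EReal.coe_ne_bot _)
      | coe A =>
        induction B with
        | bot => exact absurd rfl hbot'
        | top => rw [EReal.coe_add_top]; exact le_top
        | coe B =>
          norm_cast at h h1 ⊢
          linarith
  · intro h
    have h0 := h y
    rw [hself] at h0
    obtain ⟨k, hk⟩ : ∃ k : ℝ, radialCost f x y = k := by
      refine ⟨_, (EReal.coe_toReal (fun ht => ?_) (hf.radialCost_ne_bot x y)).symm⟩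
      rw [ht, EReal.coe_add_top, ← EReal.coe_add] at h0
      exact EReal.coe_ne_top _ (top_le_iff.1 h0)
    have hC : cTransform (radialCost f) φ y = ((-k - φ x : ℝ) : EReal) := by
      refine le_antisymm (iSup_le fun x' => ?_) ?_
      · have h1 := h x'
        have hbot' := hf.radialCost_ne_bot x' y
        rw [hk] at h1
        rw [radialCost_comm y x']
        generalize radialCost f x' y = B at *
        induction B with
        | bot => exact absurd rfl hbot'
        | top => simp
        | coe B =>
          norm_cast at h1 ⊢
          linarith
      · refine le_trans (le_of_eq ?_) (le_iSup (fun z => -(radialCost f y z) - (φ z : EReal)) x)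
        rw [radialCost_comm y x, hk, EReal.coe_sub, EReal.coe_neg]
    rw [hC, hk]
    norm_cast
    ring

/-- For a c-convex `φ` and any `x`, up to an arbitrarily small error `x` minimizes `φ + c(·,y)` for
some `y`. -/
theorem exists_almost_contact {φ : Sph m → ℝ} (hφ : IsCConvex (radialCost f) φ) (x : Sph m) {ε : ℝ}
    (hε : 0 < ε) : ∃ y : Sph m, ∃ k : ℝ, radialCost f x y = k ∧
      ∀ x', ((φ x - ε + k : ℝ) : EReal) ≤ (φ x' : EReal) + radialCost f x' y := by
  obtain ⟨ψ, hψ⟩ := hφ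
  have h1 : ((φ x - ε : ℝ) : EReal) < ⨆ y : Sph m, (-(radialCost f x y) - (ψ y : EReal)) := by
    have h2 : (φ x : EReal) = ⨆ y : Sph m, (-(radialCost f x y) - (ψ y : EReal)) := hψ x
    rw [← h2]
    exact EReal.coe_lt_coe_iff.2 (by linarith)
  obtain ⟨y, hy⟩ := lt_iSup_iff.1 h1
  obtain ⟨k, hk⟩ : ∃ k : ℝ, radialCost f x y = k := by
    refine ⟨_, (EReal.coe_toReal (fun ht => ?_) (hf.radialCost_ne_bot x y)).symm⟩
    rw [ht] at hy
    simp at hy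
  refine ⟨y, k, hk, fun x' => ?_⟩
  have h2 : -(radialCost f x' y) - (ψ y : EReal) ≤ (φ x' : EReal) := by
    rw [hψ x']
    exact le_iSup (fun z => -(radialCost f x' z) - (ψ z : EReal)) y
  have hbot' := hf.radialCost_ne_bot x' y
  rw [hk] at hy
  generalize radialCost f x' y = B at *
  induction B with
  | bot => exact absurd rfl hbot'
  | top => rw [EReal.coe_add_top]; exact le_top
  | coe B =>
    norm_cast at hy h2 ⊢
    linarith

theorem isClosed_contactSet (φ : Sph m → ℝ) (x : Sph m) :
    IsClosed (contactSet (radialCost f) φ x) := by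
  have h : contactSet (radialCost f) φ x = ⋂ x', {y | (φ x : EReal) + radialCost f x y
      ≤ (φ x' : EReal) + radialCost f x' y} := by
    ext y
    rw [hf.mem_contactSet_iff, Set.mem_iInter]
    rfl
  have hc : ∀ x : Sph m, Continuous fun y => (φ x : EReal) + radialCost f x y := by
    intro x
    refine continuous_iff_continuousAt.2 fun y => ?_
    have h3 : ContinuousAt (fun p : EReal × EReal => p.1 + p.2) ((φ x : EReal), radialCost f x y) :=
      EReal.continuousAt_add (Or.inl (EReal.coe_ne_top _)) (Or.inl (EReal.coe_ne_bot _))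
    exact ContinuousAt.comp (f := fun y : Sph m => ((φ x : EReal), radialCost f x y)) h3
      (continuous_const.prodMk (hf.continuous_radialCost_right x)).continuousAt
  rw [h]
  exact isClosed_iInter fun x' => isClosed_le (hc x) (hc x')

/-- First-order upper bound for the cost. -/
theorem eventually_radialCost_le {x y : Sph m} (h : y ≠ -x) {ε : ℝ} (hε : 0 < ε) :
    ∀ᶠ v : Tan x in 𝓝 0, radialCost f (sphExp x v) y ≤
      (((radialCost f x y).toReal - ⟪momentum f x y, v⟫ + ε * ‖v‖ : ℝ) : EReal) := by
  have h1 := hf.hasFDerivAt_radialCost h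
  rw [hasFDerivAt_iff_isLittleO_nhds_zero] at h1
  filter_upwards [h1.def hε, eventually_sphExp_ne_neg h] with v hv hv'
  rw [radialCost_eq hv', EReal.coe_le_coe_iff, ← toReal_radialCost hv']
  simp only [zero_add, sphExp_zero, innerSL_apply_apply, inner_neg_left] at hv
  have := (abs_le.1 hv).2
  linarith

theorem cSubdiff_subset_subdiff (φ : Sph m → ℝ) (x : Sph m) :
    cSubdiff (radialCost f) φ x ⊆ subdiff (fun x' => (φ x' : EReal)) x := by
  rintro p (⟨y, hy, hyx, rfl⟩ | ⟨hx, a, ha, hp⟩)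
  · rw [hf.neg_gradX_radialCost hyx]
    refine ⟨φ x, rfl, fun ε hε => ?_⟩
    filter_upwards [hf.eventually_radialCost_le hyx hε] with v hv
    have h1 := hf.mem_contactSet_iff.1 hy (sphExp x v)
    have h2 := h1.trans (add_le_add le_rfl hv)
    rw [toReal_radialCost hyx, radialCost_eq hyx] at h2
    norm_cast at h2 ⊢
    linarith
  · have hk : radialCost f x (-x) = ((-a : ℝ) : EReal) := by
      rw [EReal.coe_neg, ← ha, neg_neg]
    refine ⟨φ x, rfl, fun ε hε => ?_⟩
    filter_upwards [hp ε hε] with v hv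
    have h1 := hf.mem_contactSet_iff.1 hx (sphExp x v)
    obtain ⟨l, hl⟩ := hf.exists_radialCost_eq_coe hk (sphExp x v) (-x)
    rw [hk, hl] at h1
    rw [hl] at hv
    norm_cast at h1 hv ⊢
    linarith

end IsProfile

namespace IsConvexProfile

variable (hf : IsConvexProfile f)
include hf

/-- The sum `φ + c(·,y)` is largest at `-y`: an almost contact point of `x` is compared at `x` and at
`-y`, by means of `radialCost_add_le`. -/
theorem le_antipode_of_isCConvex {φ : Sph m → ℝ} (hφ : IsCConvex (radialCost f) φ) (x y : Sph m) :
    (φ x : EReal) + radialCost f x y ≤ (φ (-y) : EReal) + radialCost f (-y) y := by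
  by_cases hP : radialCost f (-y) y = ⊤
  · rw [hP, EReal.coe_add_top]; exact le_top
  obtain ⟨P, hP'⟩ : ∃ P : ℝ, radialCost f y (-y) = P := by
    rw [radialCost_comm]
    exact ⟨_, (EReal.coe_toReal hP (hf.radialCost_ne_bot _ _)).symm⟩
  obtain ⟨l, hl⟩ := hf.exists_radialCost_eq_coe hP' x y
  rw [hl, radialCost_comm, hP', ← EReal.coe_add, ← EReal.coe_add, EReal.coe_le_coe_iff]
  refine le_of_forall_pos_le_add fun ε hε => ?_
  obtain ⟨z, k, hk, hz⟩ := hf.exists_almost_contact hφ x hε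
  obtain ⟨n, hn⟩ := hf.exists_radialCost_eq_coe hP' (-y) z
  have h1 := hz (-y)
  have h2 := hf.radialCost_add_le x y z
  rw [hl, hn, hk, radialCost_comm (-y) y, hP'] at h2
  rw [hn] at h1
  norm_cast at h1 h2
  linarith

/-- If `-x` is a contact point of `x`, then `φ + c(·,-x)` attains its maximum and its minimum at
`x`, so it is constant. -/
theorem add_antipode_eq {φ : Sph m → ℝ} (hφ : IsCConvex (radialCost f) φ) {x : Sph m}
    (hx : -x ∈ contactSet (radialCost f) φ x) :
    ∃ k : ℝ, radialCost f x (-x) = k ∧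
      ∀ x', radialCost f x' (-x) = ((φ x - φ x' + k : ℝ) : EReal) := by
  have hmin := hf.mem_contactSet_iff.1 hx
  obtain ⟨k, hk⟩ : ∃ k : ℝ, radialCost f x (-x) = k := by
    refine ⟨_, (EReal.coe_toReal (fun ht => ?_) (hf.radialCost_ne_bot x (-x))).symm⟩
    have h0 := hmin (-x)
    rw [ht, radialCost_self (f := f), EReal.coe_add_top, ← EReal.coe_add] at h0
    exact EReal.coe_ne_top _ (top_le_iff.1 h0)
  refine ⟨k, hk, fun x' => ?_⟩
  obtain ⟨l, hl⟩ := hf.exists_radialCost_eq_coe hk x' (-x)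
  have h1 := hf.le_antipode_of_isCConvex hφ x' (-x)
  have h2 := hmin x'
  rw [neg_neg, hl, hk] at h1
  rw [hl, hk] at h2
  rw [hl]
  norm_cast at h1 h2 ⊢
  linarith

/-- The momenta of the contact points form a convex set: the global form of the maximum principle
for c-convex functions. -/
theorem convex_momentum_image (hm : 1 ≤ m) (hAs : CondAs (radialCost f : Sph m → Sph m → EReal))
    {φ : Sph m → ℝ} {x : Sph m} (hx : -x ∉ contactSet (radialCost f) φ x) :
    Convex ℝ (momentum f x '' contactSet (radialCost f) φ x) := by
  have hne : ∀ y ∈ contactSet (radialCost f) φ x, y ≠ -x := fun y hy h => hx (h ▸ hy)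
  rw [convex_iff_segment_subset]
  rintro _ ⟨y₀, hy₀, rfl⟩ _ ⟨y₁, hy₁, rfl⟩ q hq
  have h₀ := hne y₀ hy₀
  have h₁ := hne y₁ hy₁
  obtain ⟨y, hy, rfl⟩ := hf.exists_of_norm_mem hm x
    (hf.norm_mem_momRange_of_mem_segment (hf.norm_momentum_mem h₀) (hf.norm_momentum_mem h₁) hq)
  refine ⟨y, hf.mem_contactSet_iff.2 fun x' => ?_, rfl⟩
  have key : ∀ z : Sph m, z ≠ -x → z ∈ contactSet (radialCost f) φ x →
      radialCost f x y - radialCost f x' y ≤ radialCost f x z - radialCost f x' z →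
      (φ x : EReal) + radialCost f x y ≤ (φ x' : EReal) + radialCost f x' y := by
    intro z hz hzc h
    have h2 := hf.mem_contactSet_iff.1 hzc x'
    have hb := hf.radialCost_ne_bot x' y
    have hb' := hf.radialCost_ne_bot x' z
    rw [radialCost_eq hz] at h h2
    rw [radialCost_eq hy] at h ⊢
    generalize radialCost f x' y = B at *
    generalize radialCost f x' z = C at *
    induction B with
    | bot => exact absurd rfl hb
    | top => rw [EReal.coe_add_top]; exact le_top
    | coe B =>
      induction C with
      | bot => exact absurd rfl hb'
      | top =>
        rw [EReal.sub_top, ← EReal.coe_sub] at h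
        exact absurd (le_bot_iff.1 h) (EReal.coe_ne_bot _)
      | coe C =>
        norm_cast at h h2 ⊢
        linarith
  rcases le_max_iff.1 (hf.cost_sub_le_max hm hAs h₀ h₁ hy hq x') with h | h
  · exact key y₀ h₀ hy₀ h
  · exact key y₁ h₁ hy₁ h

/-- The difference quotients of `c(·,y)` at `x` in the direction `ξ` converge uniformly in `y`, away
from `-x`. -/
theorem tendsto_cosProfile_quotient {x y : Sph m} (hy : y ≠ -x) (ξ : Tan x) {t : ℕ → ℝ}
    {Y : ℕ → Sph m} (htpos : ∀ n, 0 < t n) (ht : Tendsto t atTop (𝓝 0))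
    (hY : Tendsto Y atTop (𝓝 y)) :
    Tendsto (fun n => (cosProfile f ⟪(x : Amb m), (Y n : Amb m)⟫
      - cosProfile f ⟪expVec x (t n • ξ), (Y n : Amb m)⟫) / t n) atTop
      (𝓝 ⟪momentum f x y, ξ⟫) := by
  have hu := neg_one_lt_inner_iff.2 hy
  set u := ⟪(x : Amb m), (y : Amb m)⟫ with hudef
  have hYc : Tendsto (fun n => (Y n : Amb m)) atTop (𝓝 (y : Amb m)) :=
    (continuous_subtype_val.tendsto y).comp hY
  have hA : Tendsto (fun n => ⟪(x : Amb m), (Y n : Amb m)⟫) atTop (𝓝 u) :=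
    tendsto_const_nhds.inner hYc
  have hline := hasDerivAt_expVec_line x ξ
  have hXc : Tendsto (fun n => expVec x (t n • ξ)) atTop (𝓝 (x : Amb m)) := by
    have h1 : Tendsto (fun s : ℝ => expVec x (s • ξ)) (𝓝 0) (𝓝 (x : Amb m)) := by
      simpa only [zero_smul, expVec_zero] using hline.continuousAt.tendsto
    exact h1.comp ht
  have hB : Tendsto (fun n => ⟪expVec x (t n • ξ), (Y n : Amb m)⟫) atTop (𝓝 u) := hXc.inner hYc
  have hquot : Tendsto (fun n => (⟪(x : Amb m), (Y n : Amb m)⟫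
      - ⟪expVec x (t n • ξ), (Y n : Amb m)⟫) / t n) atTop (𝓝 (-⟪(ξ : Amb m), (y : Amb m)⟫)) := by
    have h0 : Tendsto t atTop (𝓝[≠] 0) :=
      tendsto_nhdsWithin_iff.2 ⟨ht, Eventually.of_forall fun n => (htpos n).ne'⟩
    have h1 : Tendsto (fun n => (t n)⁻¹ • (expVec x (t n • ξ) - (x : Amb m))) atTop
        (𝓝 (ξ : Amb m)) := by
      refine ((hasDerivAt_iff_tendsto_slope_zero.1 hline).comp h0).congr fun n => ?_
      simp only [Function.comp, zero_add, zero_smul, expVec_zero]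
    refine (h1.inner hYc).neg.congr fun n => ?_
    rw [real_inner_smul_left, inner_sub_left]
    ring
  have h1 := (hf.hasStrictDerivAt_cosProfile hu).isLittleO.comp_tendsto (hA.prodMk_nhds hB)
  have h2 : (fun n => ⟪(x : Amb m), (Y n : Amb m)⟫ - ⟪expVec x (t n • ξ), (Y n : Amb m)⟫)
      =O[atTop] t := by
    refine ((hquot.isBigO_one ℝ).mul (Asymptotics.isBigO_refl t atTop)).congr
      (fun n => div_mul_cancel₀ _ (htpos n).ne') (fun n => one_mul _)
  have h3 := (h1.trans_isBigO h2).tendsto_div_nhds_zero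
  have h4 := h3.add (hquot.mul_const (-radialFactor f u))
  have h5 : 0 + -⟪(ξ : Amb m), (y : Amb m)⟫ * -radialFactor f u = ⟪momentum f x y, ξ⟫ := by
    rw [momentum, real_inner_smul_left, inner_tanProj]; ring
  rw [h5] at h4
  refine h4.congr fun n => ?_
  simp only [Function.comp, ContinuousLinearMap.toSpanSingleton_apply, smul_eq_mul]
  ring

/-- Every subgradient of `φ` at `x` is dominated, in any given direction, by the momentum of a
contact point. It is found as a limit of almost contact points for points approaching `x` in this
direction. -/
theorem exists_contact_inner_le {φ : Sph m → ℝ} (hφ : IsCConvex (radialCost f) φ) {x : Sph m}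
    {p : Tan x} (hp : p ∈ subdiff (fun x' => (φ x' : EReal)) x) (ξ : Tan x) :
    ∃ y ∈ contactSet (radialCost f) φ x, y ≠ -x → ⟪p, ξ⟫ ≤ ⟪momentum f x y, ξ⟫ := by
  obtain ⟨a, ha, hp⟩ := hp
  replace ha : φ x = a := EReal.coe_injective ha
  subst ha
  obtain ⟨t, Y, y, htpos, ht, hYy, hY⟩ : ∃ (t : ℕ → ℝ) (Y : ℕ → Sph m) (y : Sph m),
      (∀ n, 0 < t n) ∧ Tendsto t atTop (𝓝 0) ∧ Tendsto Y atTop (𝓝 y) ∧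
      ∀ n, ∃ k : ℝ, radialCost f (sphExp x (t n • ξ)) (Y n) = k ∧ ∀ x',
        ((φ (sphExp x (t n • ξ)) - t n ^ 2 + k : ℝ) : EReal)
          ≤ (φ x' : EReal) + radialCost f x' (Y n) := by
    have htpos : ∀ n : ℕ, 0 < 1 / ((n : ℝ) + 1) := fun n => by positivity
    choose Y hY using fun n : ℕ =>
      hf.exists_almost_contact hφ (sphExp x ((1 / ((n : ℝ) + 1)) • ξ)) (pow_pos (htpos n) 2)
    obtain ⟨y, -, σ, hσ, hlim⟩ := isCompact_univ.tendsto_subseq (x := Y) fun n => Set.mem_univ _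
    exact ⟨fun n => 1 / ((σ n : ℝ) + 1), fun n => Y (σ n), y, fun n => htpos (σ n),
      tendsto_one_div_add_atTop_nhds_zero_nat.comp hσ.tendsto_atTop, hlim, fun n => hY (σ n)⟩
  have htξ : Tendsto (fun n => t n • ξ) atTop (𝓝 0) := by
    simpa only [zero_smul] using ht.smul_const ξ
  have hX : Tendsto (fun n => sphExp x (t n • ξ)) atTop (𝓝 x) := by
    have h1 : Tendsto (sphExp x) (𝓝 0) (𝓝 x) := by
      simpa only [sphExp_zero] using (continuous_sphExp x).tendsto 0
    exact h1.comp htξ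
  have hφX : ∀ ε : ℝ, 0 < ε → ∀ᶠ n in atTop,
      φ x + t n * ⟪p, ξ⟫ - ε * (t n * ‖ξ‖) ≤ φ (sphExp x (t n • ξ)) := by
    intro ε hε
    filter_upwards [htξ.eventually (hp ε hε)] with n hn
    have hn' := EReal.coe_le_coe_iff.1 hn
    rwa [real_inner_smul_right, norm_smul, Real.norm_of_nonneg (htpos n).le] at hn'
  refine ⟨y, hf.mem_contactSet_iff.2 fun x' => ?_, fun hy => ?_⟩
  · have hb : Tendsto (fun n => φ x + t n * ⟪p, ξ⟫ - 1 * (t n * ‖ξ‖) - t n ^ 2) atTop (𝓝 (φ x)) := by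
      have h1 := (((ht.mul_const ⟪p, ξ⟫).const_add (φ x)).sub
        ((ht.mul_const ‖ξ‖).const_mul 1)).sub (ht.pow 2)
      simpa using h1
    have hL := tendsto_coe_add hb (hf.tendsto_radialCost (hX.prodMk_nhds hYy))
    have hR := tendsto_coe_add (tendsto_const_nhds (x := φ x'))
      (hf.tendsto_radialCost ((tendsto_const_nhds (x := x')).prodMk_nhds hYy))
    refine le_of_tendsto_of_tendsto hL hR ?_
    filter_upwards [hφX 1 one_pos] with n hn
    obtain ⟨k, hk, hYk⟩ := hY n
    refine le_trans ?_ (hYk x')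
    rw [hk, ← EReal.coe_add, EReal.coe_le_coe_iff]
    linarith
  · have hstrict := hf.tendsto_cosProfile_quotient hy ξ htpos ht hYy
    have hmain : ∀ ε : ℝ, 0 < ε → ⟪p, ξ⟫ - ε * ‖ξ‖ ≤ ⟪momentum f x y, ξ⟫ := by
      intro ε hε
      have hL : Tendsto (fun n => ⟪p, ξ⟫ - ε * ‖ξ‖ - t n) atTop (𝓝 (⟪p, ξ⟫ - ε * ‖ξ‖)) := by
        simpa only [sub_zero] using ht.const_sub (⟪p, ξ⟫ - ε * ‖ξ‖)
      refine le_of_tendsto_of_tendsto hL hstrict ?_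
      filter_upwards [hφX ε hε, eventually_ne_neg_of_tendsto hy (tendsto_const_nhds (x := x)) hYy,
        eventually_ne_neg_of_tendsto hy hX hYy] with n hn hA hB
      obtain ⟨k, hk, hYk⟩ := hY n
      have h1 := hYk x
      rw [radialCost_eq hA, ← EReal.coe_add, EReal.coe_le_coe_iff] at h1
      rw [radialCost_eq hB, EReal.coe_eq_coe_iff, coe_sphExp] at hk
      rw [← hk] at h1
      rw [le_div_iff₀ (htpos n)]
      linarith
    have hL : Tendsto (fun ε : ℝ => ⟪p, ξ⟫ - ε * ‖ξ‖) (𝓝[>] 0) (𝓝 ⟪p, ξ⟫) := by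
      have hc : Continuous fun ε : ℝ => ⟪p, ξ⟫ - ε * ‖ξ‖ := by fun_prop
      have := (hc.tendsto 0).mono_left (nhdsWithin_le_nhds (s := Set.Ioi (0 : ℝ)))
      simpa only [zero_mul, sub_zero] using this
    exact le_of_tendsto hL (by filter_upwards [self_mem_nhdsWithin] with ε hε using hmain ε hε)

/-- Away from antipodal contact the momenta of the contact points form a compact convex set; a
subgradient outside would be strictly separated from it, against `exists_contact_inner_le`. -/
theorem subdiff_subset_cSubdiff (hm : 1 ≤ m)
    (hAs : CondAs (radialCost f : Sph m → Sph m → EReal)) {φ : Sph m → ℝ}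
    (hφ : IsCConvex (radialCost f) φ) (x : Sph m) :
    subdiff (fun x' => (φ x' : EReal)) x ⊆ cSubdiff (radialCost f) φ x := by
  intro p hp
  by_cases hx : -x ∈ contactSet (radialCost f) φ x
  · refine Or.inr ⟨hx, ?_⟩
    obtain ⟨k, hk, hconst⟩ := hf.add_antipode_eq hφ hx
    obtain ⟨a, ha, hp⟩ := hp
    replace ha : φ x = a := EReal.coe_injective ha
    refine ⟨-k, by simp only [hk, EReal.coe_neg], fun ε hε => ?_⟩
    filter_upwards [hp ε hε] with v hv
    rw [hconst, ← EReal.coe_neg, EReal.coe_le_coe_iff]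
    have := EReal.coe_le_coe_iff.1 hv
    linarith
  · left
    have hne : ∀ y ∈ contactSet (radialCost f) φ x, y ≠ -x := fun y hy h => hx (h ▸ hy)
    have hcomp : IsCompact (momentum f x '' contactSet (radialCost f) φ x) :=
      (hf.isClosed_contactSet φ x).isCompact.image_of_continuousOn
        ((hf.continuousOn_momentum x).mono hne)
    have hmem : p ∈ momentum f x '' contactSet (radialCost f) φ x := by
      by_contra hpn
      obtain ⟨g, u, hgp, hg⟩ := geometric_hahn_banach_point_closed
        (hf.convex_momentum_image hm hAs hx) hcomp.isClosed hpn
      obtain ⟨η, rfl⟩ := (InnerProductSpace.toDual ℝ (Tan x)).surjective g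
      obtain ⟨y, hy, hle⟩ := hf.exists_contact_inner_le hφ hp (-η)
      have h1 := hle (hne y hy)
      have h2 := hg _ ⟨y, hy, rfl⟩
      rw [InnerProductSpace.toDual_apply_apply] at hgp h2
      rw [inner_neg_right, inner_neg_right, real_inner_comm, real_inner_comm η (momentum f x y)]
        at h1
      linarith
    obtain ⟨y, hy, rfl⟩ := hmem
    exact ⟨y, hy, hne y hy, (hf.neg_gradX_radialCost (hne y hy)).symm⟩

/-- A critical point `x` of `φ + c(·,y)` gives the subgradient `-∇ₓ c(x,y)` of `φ`. It belongs to
`∂ᶜφ(x)`, so that `y` is a contact point of `x` by the injectivity of the momentum, unless `-x` is a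
contact point; in this case `φ + c(·,-x)` is constant, and `radialCost_add_le` applies. -/
theorem isMin_of_isCritical (hm : 1 ≤ m) (hAs : CondAs (radialCost f : Sph m → Sph m → EReal))
    {φ : Sph m → ℝ} (hφ : IsCConvex (radialCost f) φ) {x y : Sph m} (hxy : y ≠ -x)
    (hcrit : IsCritical (fun x' => (φ x' : EReal) + radialCost f x' y) x) (x' : Sph m) :
    (φ x : EReal) + radialCost f x y ≤ (φ x' : EReal) + radialCost f x' y := by
  have hp : momentum f x y ∈ subdiff (fun x' => (φ x' : EReal)) x := by
    obtain ⟨a, ha, hc⟩ := hcrit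
    refine ⟨φ x, rfl, fun ε hε => ?_⟩
    filter_upwards [hc (ε / 2) (half_pos hε), hf.eventually_radialCost_le hxy (half_pos hε)]
      with v hv hv'
    have h2 := hv.trans (add_le_add le_rfl hv')
    have ha' : φ x + cosProfile f ⟪(x : Amb m), (y : Amb m)⟫ = a := by
      simp only [radialCost_eq hxy] at ha
      exact_mod_cast ha
    rw [toReal_radialCost hxy, ← EReal.coe_add, EReal.coe_le_coe_iff, inner_zero_left] at h2
    rw [EReal.coe_le_coe_iff]
    linarith
  rcases hf.subdiff_subset_cSubdiff hm hAs hφ x hp with ⟨z, hz, hzx, hpz⟩ | ⟨hx, -⟩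
  · rw [hf.neg_gradX_radialCost hzx] at hpz
    rw [hf.momentum_injOn x hxy hzx hpz]
    exact hf.mem_contactSet_iff.1 hz x'
  · obtain ⟨k, hk, hconst⟩ := hf.add_antipode_eq hφ hx
    obtain ⟨l, hl⟩ := hf.exists_radialCost_eq_coe hk x y
    obtain ⟨n, hn⟩ := hf.exists_radialCost_eq_coe hk x' y
    have h1 := hf.radialCost_add_le x' (-x) y
    rw [neg_neg, hconst x', hl, hk, hn] at h1
    rw [hl, hn]
    norm_cast at h1 ⊢
    linarith

theorem cSegmentWellDefined (hm : 1 ≤ m) {x y₀ y₁ : Sph m} (h₀ : y₀ ≠ -x) (h₁ : y₁ ≠ -x) :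
    CSegmentWellDefined (radialCost f) x y₀ y₁ := by
  intro q hq
  rw [hf.neg_gradX_radialCost h₀, hf.neg_gradX_radialCost h₁] at hq
  obtain ⟨y, hy, rfl⟩ := hf.exists_of_norm_mem hm x
    (hf.norm_mem_momRange_of_mem_segment (hf.norm_momentum_mem h₀) (hf.norm_momentum_mem h₁) hq)
  exact ⟨y, hy, hf.neg_gradX_radialCost hy⟩

end IsConvexProfile

end Contact

end SphereCost

end

theorem theorem4p1 (m : ℕ) (hm : 1 ≤ m) (f : ℝ → ℝ)
    (hf_smooth : ContDiffOn ℝ ∞ f (Set.Ico 0 Real.pi))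
    (hf_mono : StrictMonoOn f (Set.Ico 0 Real.pi))
    (hf_zero : derivWithin f (Set.Ico 0 Real.pi) 0 = 0)
    (c : SphereCost.Sph m → SphereCost.Sph m → EReal)
    (hc : c = SphereCost.radialCost f)
    (hA0 : SphereCost.CondA0 c) (hA1 : SphereCost.CondA1 c)
    (hA2 : SphereCost.CondA2 c) (hAs : SphereCost.CondAs c) :
    (∀ x y₀ y₁ : SphereCost.Sph m, y₀ ≠ -x → y₁ ≠ -x →
      SphereCost.CSegmentWellDefined c x y₀ y₁ ∧
        ∀ y ∈ SphereCost.cSegment c x y₀ y₁, y ≠ -x) ∧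
    (∀ φ : SphereCost.Sph m → ℝ, SphereCost.IsCConvex c φ → ∀ y : SphereCost.Sph m,
      (∀ x, (φ x : EReal) + c x y ≤ (φ (-y) : EReal) + c (-y) y) ∧
      (∀ x, x ≠ -y → SphereCost.IsCritical (fun x' => (φ x' : EReal) + c x' y) x →
        ∀ x', (φ x : EReal) + c x y ≤ (φ x' : EReal) + c x' y)) ∧
    (∀ φ : SphereCost.Sph m → ℝ, SphereCost.IsCConvex c φ → ∀ x : SphereCost.Sph m,
      SphereCost.subdiff (fun x' => (φ x' : EReal)) x = SphereCost.cSubdiff c φ x) := by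
  subst hc
  have hf : SphereCost.IsConvexProfile f :=
    SphereCost.IsProfile.isConvexProfile hm ⟨hf_smooth, hf_mono, hf_zero⟩ hA1 hA2
  refine ⟨fun x y₀ y₁ h₀ h₁ => ⟨hf.cSegmentWellDefined hm h₀ h₁, fun y hy => hy.1⟩,
    fun φ hφ y => ⟨fun x => hf.le_antipode_of_isCConvex hφ x y, fun x hx hcrit =>
      hf.isMin_of_isCritical hm hAs hφ (SphereCost.ne_neg_comm.2 hx) hcrit⟩,
    fun φ hφ x => Set.Subset.antisymm (hf.subdiff_subset_cSubdiff hm hAs hφ x)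
      (hf.cSubdiff_subset_subdiff φ x)⟩
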